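/- \textbf{Model.} There are $n$ items with an unknown underlying total order. A deterministic $r$-round comparison algorithm proceeds in $r$ rounds; in each round it performs simultaneously a finite set of pairwise comparisons, chosen depending on the results of the previous rounds, and after the last round it outputs a list of items. Comparisons are noiseless, i.e. always consistent with the underlying order. A randomized $r$-round algorithm is a probability distribution on deterministic $r$-round algorithms. It \emph{always solves sorted top-$k$} if, for every underlying order and every outcome of its randomness, it outputs the list of the $k$ best items in the correct order, from best to worst. \textbf{Theorem.} (a) For every fixed integer $r\ge 3$ there are a family of randomized $r$-round algorithms $A_{n,k}$ and constants $C,c$ (depending only on $r$) such that for all integers $0\le k\le n$ the algorithm $A_{n,k}$ on $n$ items always solves sorted top-$k$, and for every underlying order its expected total number of comparisons is at most $$C\,\bigl(n^{2/r}k^{(r-1)/r}+n\bigr)\,(1+\log n)^{c}$$ (with the convention $\log 0=0$), i.e. it is $\tilde O\bigl(n^{2/r}k^{(r-1)/r}+n\bigr)$, where $\tilde O$ hides factors polylogarithmic in $n$. (b) There are a family of randomized $2$-round algorithms $A_{n,k}$ and an absolute constant $C$ such that for all integers $0\le k\le n$ the algorithm $A_{n,k}$ on $n$ items always solves sorted top-$k$,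 and for every underlying order its expected total number of comparisons is at most $$C\,\bigl(n\sqrt{k}+n^{4/3}\bigr).$$ -/

import Mathlib

open scoped ENNReal

/-- A deterministic `r`-round noiseless comparison algorithm on the items `0, …, n - 1`.
In every round it submits a finite set `Q` of comparisons simultaneously; it then receives one
bit for each of them and continues in a way that depends on these bits (and, through the position
in the tree, on all answers of the earlier rounds). After the last round it outputs a list. -/
inductive RoundAlg (n : ℕ) : ℕ → Type
  | output (l : List (Fin n)) : RoundAlg n 0
  | round {r : ℕ} (Q : Finset (Fin n × Fin n)) (next : (Q → Bool) → RoundAlg n r) :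
      RoundAlg n (r + 1)

namespace RoundAlg

variable {n : ℕ}

/-- The noiseless answers to the comparisons in `Q`. The underlying order is given by
`rank`, where a smaller rank is better; the answer to `(x, y)` says whether `x` is better
than `y`. -/
def answers (rank : Equiv.Perm (Fin n)) (Q : Finset (Fin n × Fin n)) : Q → Bool :=
  fun q => decide (rank q.1.1 < rank q.1.2)

/-- The output of the algorithm when the underlying order is `rank`. -/
def result (rank : Equiv.Perm (Fin n)) : {r : ℕ} → RoundAlg n r → List (Fin n)
  | _, output l => l
  | _, round Q next => result rank (next (answers rank Q))

/-- The total number of comparisons, over all rounds, when the underlying order is `rank`. -/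
def comparisons (rank : Equiv.Perm (Fin n)) : {r : ℕ} → RoundAlg n r → ℕ
  | _, output _ => 0
  | _, round Q next => Q.card + comparisons rank (next (answers rank Q))

end RoundAlg

/-- `l` is the list of the `k` best items, from the best one downwards. -/
def IsSortedTopK {n : ℕ} (rank : Equiv.Perm (Fin n)) (k : ℕ) (l : List (Fin n)) : Prop :=
  l.length = k ∧ l.Pairwise (fun x y => rank x < rank y) ∧
    ∀ x ∈ l, ∀ y, y ∉ l → rank x < rank y

/-- A randomized `r`-round comparison algorithm: a probability distribution on deterministic
`r`-round comparison algorithms. -/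
abbrev RandomizedRoundAlg (n r : ℕ) : Type := PMF (RoundAlg n r)

namespace RandomizedRoundAlg

variable {n r : ℕ}

/-- The algorithm always solves sorted top-`k`: for every underlying order and every outcome of
its random choices, the output is correct. -/
def AlwaysSolvesSortedTopK (A : RandomizedRoundAlg n r) (k : ℕ) : Prop :=
  ∀ D ∈ A.support, ∀ rank : Equiv.Perm (Fin n), IsSortedTopK rank k (D.result rank)

/-- The expected total number of comparisons when the underlying order is `rank`. -/
noncomputable def expectedComparisons (A : RandomizedRoundAlg n r)
    (rank : Equiv.Perm (Fin n)) : ℝ≥0∞ :=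
  ∑' D, A D * (D.comparisons rank : ℝ≥0∞)

end RandomizedRoundAlg

/-! ### Knowledge as the set of orders consistent with the answers -/

namespace RoundAlg

variable {n : ℕ}

/-! Both algorithms are quicksorts with many random pivots per round. The state is the set `R` of
orders consistent with the answers. The output is read off any remaining order, so correctness does
not depend on the random choices (`isSortedTopK_topList`).

For (a) let r = m + 2; level 0 consists of all items, level j of about n/ρ^j random ones. Round 1
compares all items with T = level m+1 and sorts S = level m, at cost about n²/ρ^(m+1). It leaves the
top K and about ρ^(m+1) other items. In round 2 only the roughly K/ρ^m best pivots of S are used; a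
top-K item has about ρ of them in its gap of T, and each other item meets at most all of them, so
both groups cost about Kρ. About K + ρ^m items survive, and each further round refines the gaps by
one level at about ρ comparisons per item.

Choosing Kρ^(m+2) = n² makes the total Kρ + ρ^(m+1). For K = k the first term is the claimed one;
for small k the cut-off K is raised until ρ^(m+1) ≤ n, and then Kρ = O(n) (`exists_cutoff_ratio`).
All this holds up to logarithms if every level is evenly spread (`comparisons_siftAndSort_le`); a
sample fails this with probability O(n⁻²) (`card_not_spread_le`), and then the trivial bound
`comparisons_le` suffices.

For (b) there is one pivot set, of size s. The expected number of open pairs among the survivors is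
summed directly, which avoids logarithms: the total is about ns + kn/s + (n/s)²
(`sum_comparisons_pruneAndSort_le`). -/

theorem comparisons_le (rank : Equiv.Perm (Fin n)) {r : ℕ} (D : RoundAlg n r) :
    D.comparisons rank ≤ r * (n * n) := by
  induction D with
  | output l => simp [comparisons]
  | @round r Q next ih =>
    have h1 : Q.card ≤ n * n := by
      have := Finset.card_le_univ Q
      simpa using this
    have h2 := ih (answers rank Q)
    simp only [comparisons]
    rw [Nat.succ_mul]
    omega

/-- The orders in `R` that give the same answers to the comparisons `Q` as `rank`. -/
def consistent (rank : Equiv.Perm (Fin n)) (Q : Finset (Fin n × Fin n))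
    (R : Set (Equiv.Perm (Fin n))) : Set (Equiv.Perm (Fin n)) :=
  {σ ∈ R | answers σ Q = answers rank Q}

/-- Perform the comparisons `Q` and continue with those orders in `R` that are consistent with
the answers. -/
def ask {r : ℕ} (Q : Finset (Fin n × Fin n)) (R : Set (Equiv.Perm (Fin n)))
    (next : Set (Equiv.Perm (Fin n)) → RoundAlg n r) : RoundAlg n (r + 1) :=
  round Q fun a => next {σ ∈ R | answers σ Q = a}

theorem result_ask (rank : Equiv.Perm (Fin n)) {r : ℕ} (Q : Finset (Fin n × Fin n))
    (R : Set (Equiv.Perm (Fin n))) (next : Set (Equiv.Perm (Fin n)) → RoundAlg n r) :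
    (ask Q R next).result rank = (next (consistent rank Q R)).result rank := rfl

theorem comparisons_ask (rank : Equiv.Perm (Fin n)) {r : ℕ} (Q : Finset (Fin n × Fin n))
    (R : Set (Equiv.Perm (Fin n))) (next : Set (Equiv.Perm (Fin n)) → RoundAlg n r) :
    (ask Q R next).comparisons rank =
      Q.card + (next (consistent rank Q R)).comparisons rank := rfl

/-- All orders in `R` agree that `x` is better than `y`. -/
def Known (R : Set (Equiv.Perm (Fin n))) (x y : Fin n) : Prop := ∀ σ ∈ R, σ x < σ y

/-- The orders in `R` leave the comparison of `x` and `y` open. -/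
def Undecided (R : Set (Equiv.Perm (Fin n))) (x y : Fin n) : Prop :=
  ¬ Known R x y ∧ ¬ Known R y x

variable {R R' : Set (Equiv.Perm (Fin n))} {Q : Finset (Fin n × Fin n)}
  {rank : Equiv.Perm (Fin n)} {x y z : Fin n}

theorem consistent_subset : consistent rank Q R ⊆ R := fun _ h => h.1

theorem mem_consistent (h : rank ∈ R) : rank ∈ consistent rank Q R := ⟨h, rfl⟩

theorem Known.mono (h : Known R x y) (hR : R' ⊆ R) : Known R' x y := fun σ hσ => h σ (hR hσ)

theorem Known.trans (h : Known R x y) (h' : Known R y z) : Known R x z :=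
  fun σ hσ => (h σ hσ).trans (h' σ hσ)

theorem Undecided.symm (h : Undecided R x y) : Undecided R y x := ⟨h.2, h.1⟩

theorem mem_consistent_iff {σ : Equiv.Perm (Fin n)} :
    σ ∈ consistent rank Q R ↔
      σ ∈ R ∧ ∀ x y, (x, y) ∈ Q → (σ x < σ y ↔ rank x < rank y) := by
  constructor
  · rintro ⟨h1, h2⟩
    refine ⟨h1, fun x y hxy => ?_⟩
    have := congrFun h2 ⟨(x, y), hxy⟩
    simpa [answers] using this
  · rintro ⟨h1, h2⟩
    refine ⟨h1, ?_⟩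
    funext ⟨⟨x, y⟩, hxy⟩
    simpa [answers] using h2 x y hxy

theorem known_consistent_of_mem (h : (x, y) ∈ Q) (hxy : rank x < rank y) :
    Known (consistent rank Q R) x y :=
  fun _ hσ => ((mem_consistent_iff.1 hσ).2 x y h).2 hxy

theorem known_consistent_of_mem_swap (h : (y, x) ∈ Q) (hxy : rank x < rank y) :
    Known (consistent rank Q R) x y := by
  intro σ hσ
  have h1 := (mem_consistent_iff.1 hσ).2 y x h
  have h2 : ¬ σ y < σ x := fun h3 => lt_asymm hxy (h1.1 h3)
  have h3 : σ x ≠ σ y := fun h4 => by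
    rw [σ.injective h4] at hxy
    exact lt_irrefl _ hxy
  exact lt_of_le_of_ne (not_lt.1 h2) h3

/-- The `k` first items of the order `σ`, from the best one downwards. -/
def topList (σ : Equiv.Perm (Fin n)) (k : ℕ) : List (Fin n) :=
  ((List.finRange n).take k).map σ.symm

theorem mem_topList {σ : Equiv.Perm (Fin n)} {k : ℕ} : x ∈ topList σ k ↔ (σ x : ℕ) < k := by
  simp only [topList, List.mem_map, List.mem_take_iff_getElem]
  constructor
  · rintro ⟨a, ⟨i, hi, rfl⟩, rfl⟩
    simp at hi ⊢
    omega
  · intro h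
    refine ⟨σ x, ⟨σ x, ?_, ?_⟩, by simp⟩
    · simp [h]
    · simp

theorem pairwise_topList (σ : Equiv.Perm (Fin n)) (k : ℕ) :
    (topList σ k).Pairwise fun x y => σ x < σ y := by
  rw [topList, List.pairwise_map]
  simp only [Equiv.apply_symm_apply]
  exact (List.pairwise_lt_finRange n).sublist (List.take_sublist _ _)

theorem card_rank_lt (rank : Equiv.Perm (Fin n)) {k : ℕ} (hk : k ≤ n) :
    (Finset.univ.filter fun x => (rank x : ℕ) < k).card = k := by
  have h1 : (Finset.univ.filter fun x => (rank x : ℕ) < k).map rank.toEmbedding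
      = Finset.univ.filter fun i : Fin n => (i : ℕ) < k := by
    ext i
    simp
  rw [← Finset.card_map rank.toEmbedding, h1]
  have := Fin.card_filter_val_lt (n := n) (m := k)
  simpa [hk] using this

/-- Both top sets have `k` elements, so if they differed, some pair in `B` would be ordered
oppositely by `σ` and `rank`. Hence only the order on a small candidate set has to be determined. -/
theorem isSortedTopK_topList {σ : Equiv.Perm (Fin n)} {k : ℕ} (hk : k ≤ n)
    (B : Finset (Fin n)) (hσ : ∀ x, (σ x : ℕ) < k → x ∈ B) (hr : ∀ x, (rank x : ℕ) < k → x ∈ B)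
    (hB : ∀ x ∈ B, ∀ y ∈ B, σ x < σ y → rank x < rank y) :
    IsSortedTopK rank k (topList σ k) := by
  have hsub : (Finset.univ.filter fun x => (σ x : ℕ) < k) ⊆
      Finset.univ.filter fun x => (rank x : ℕ) < k := by
    intro x hx
    simp only [Finset.mem_filter, Finset.mem_univ, true_and] at hx ⊢
    by_contra hxk
    have : ∃ z, (rank z : ℕ) < k ∧ ¬ (σ z : ℕ) < k := by
      by_contra! hcon
      have hss : (Finset.univ.filter fun x => (rank x : ℕ) < k) ⊂
          Finset.univ.filter fun x => (σ x : ℕ) < k := by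
        refine Finset.ssubset_iff_subset_ne.2 ⟨?_, ?_⟩
        · intro z hz
          simp only [Finset.mem_filter, Finset.mem_univ, true_and] at hz ⊢
          exact hcon z hz
        · intro h
          have : x ∈ Finset.univ.filter fun x => (rank x : ℕ) < k := by rw [h]; simpa using hx
          simp at this
          omega
      have := Finset.card_lt_card hss
      rw [card_rank_lt _ hk, card_rank_lt _ hk] at this
      omega
    obtain ⟨z, hz1, hz2⟩ := this
    have h1 : σ x < σ z := by rw [Fin.lt_def]; omega
    have h2 := hB x (hσ x hx) z (hr z hz1) h1
    rw [Fin.lt_def] at h2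
    omega
  have heq := Finset.eq_of_subset_of_card_le hsub (by rw [card_rank_lt _ hk, card_rank_lt _ hk])
  refine ⟨by simp [topList, hk], ?_, ?_⟩
  · refine (pairwise_topList σ k).imp_of_mem ?_
    intro a b ha hb hab
    exact hB a (hσ a (mem_topList.1 ha)) b (hσ b (mem_topList.1 hb)) hab
  · intro x hx y hy
    rw [mem_topList] at hx hy
    have h1 : x ∈ Finset.univ.filter fun x => (rank x : ℕ) < k := by rw [← heq]; simpa using hx
    have h2 : y ∉ Finset.univ.filter fun x => (rank x : ℕ) < k := by rw [← heq]; simpa using hy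
    simp only [Finset.mem_filter, Finset.mem_univ, true_and] at h1 h2
    rw [Fin.lt_def]
    omega

open Classical in
/-- The `k` first items according to some order in `R`. -/
noncomputable def guess (R : Set (Equiv.Perm (Fin n))) (k : ℕ) : List (Fin n) :=
  if h : R.Nonempty then topList h.some k else []

open Classical in
/-- The pairs in `A × Z` whose comparison is left open by `R`. -/
noncomputable def undecidedPairs (R : Set (Equiv.Perm (Fin n))) (A Z : Finset (Fin n)) :
    Finset (Fin n × Fin n) :=
  (A ×ˢ Z).filter fun q => Undecided R q.1 q.2

theorem mem_undecidedPairs {A Z : Finset (Fin n)} :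
    (x, y) ∈ undecidedPairs R A Z ↔ (x ∈ A ∧ y ∈ Z) ∧ Undecided R x y := by
  simp [undecidedPairs]

/-- After comparing the undecided pairs in `A × Z`, all pairs in `A × Z` are decided. -/
theorem known_consistent_undecidedPairs {A Z : Finset (Fin n)} (hR : rank ∈ R) (hx : x ∈ A)
    (hz : z ∈ Z) (h : rank x < rank z) :
    Known (consistent rank (undecidedPairs R A Z) R) x z := by
  by_cases hu : Undecided R x z
  · exact known_consistent_of_mem (mem_undecidedPairs.2 ⟨⟨hx, hz⟩, hu⟩) h
  · have : ¬ Known R z x := fun h' => lt_asymm h (h' rank hR)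
    have h2 : Known R x z := by
      by_contra h3
      exact hu ⟨h3, this⟩
    exact h2.mono consistent_subset

theorem known_consistent_undecidedPairs_swap {A Z : Finset (Fin n)} (hR : rank ∈ R) (hx : x ∈ A)
    (hz : z ∈ Z) (h : rank z < rank x) :
    Known (consistent rank (undecidedPairs R A Z) R) z x := by
  by_cases hu : Undecided R x z
  · exact known_consistent_of_mem_swap (mem_undecidedPairs.2 ⟨⟨hx, hz⟩, hu⟩) h
  · have : ¬ Known R x z := fun h' => lt_asymm h (h' rank hR)
    have h2 : Known R z x := by
      by_contra h3
      exact hu ⟨this, h3⟩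
    exact h2.mono consistent_subset

/-! ### Sorting a candidate set and discarding items -/

/-- Sort the items of `B` in `m` rounds, where the `i`-th round from the end compares them with the
pivots in `S (i - 1)`. -/
noncomputable def sortWithin (B : Finset (Fin n)) (S : ℕ → Finset (Fin n)) (k : ℕ) :
    (m : ℕ) → Set (Equiv.Perm (Fin n)) → RoundAlg n m
  | 0, R => output (guess R k)
  | m + 1, R => ask (undecidedPairs R B (S m ∩ B)) R (sortWithin B S k m)

/-- The last round has all of `B` as pivots and settles every pair in `B`; the earlier pivots only
reduce the cost. -/
theorem isSortedTopK_sortWithin {B : Finset (Fin n)} {S : ℕ → Finset (Fin n)} {k : ℕ} (hk : k ≤ n)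
    (hS : S 0 = Finset.univ) (m : ℕ) (hR : rank ∈ R)
    (hB : ∀ σ ∈ R, ∀ x, (σ x : ℕ) < k → x ∈ B) :
    IsSortedTopK rank k ((sortWithin B S k (m + 1) R).result rank) := by
  induction m generalizing R with
  | zero =>
    rw [sortWithin, result_ask, hS, Finset.univ_inter]
    set R' := consistent rank (undecidedPairs R B B) R with hR'
    have hmem : rank ∈ R' := mem_consistent hR
    have hne : R'.Nonempty := ⟨rank, hmem⟩
    simp only [sortWithin, result, guess, hne, dite_true]
    refine isSortedTopK_topList hk B (hB _ (consistent_subset hne.some_mem)) (hB _ hR) ?_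
    intro x hx y hy hxy
    by_contra hcon
    have hxy' : rank x ≠ rank y := fun h => by
      rw [rank.injective h] at hxy
      exact lt_irrefl _ hxy
    have h1 : rank y < rank x := lt_of_le_of_ne (not_lt.1 hcon) hxy'.symm
    have h2 : Known R' y x := known_consistent_undecidedPairs hR hy hx h1
    exact lt_asymm hxy (h2 _ hne.some_mem)
  | succ m ih =>
    rw [sortWithin, result_ask]
    exact ih (mem_consistent hR) fun σ hσ => hB σ (consistent_subset hσ)

open Classical in
/-- The items of `A` that are not known to be preceded by an item of `Z` which is known to be
outside the top `K`. -/
noncomputable def survivors (K : ℕ) (Z : Finset (Fin n)) (R : Set (Equiv.Perm (Fin n)))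
    (A : Finset (Fin n)) : Finset (Fin n) :=
  A.filter fun x => ¬ ∃ z ∈ Z, ∀ σ ∈ R, K ≤ (σ z : ℕ) ∧ σ z < σ x

theorem mem_survivors {K : ℕ} {Z A : Finset (Fin n)} :
    x ∈ survivors K Z R A ↔ x ∈ A ∧ ¬ ∃ z ∈ Z, ∀ σ ∈ R, K ≤ (σ z : ℕ) ∧ σ z < σ x := by
  simp [survivors]

/-- Discarding requires agreement of all orders in `R`, so the top `K` of every order still possible
survives, as `isSortedTopK_sortWithin` demands. -/
theorem mem_survivors_of_lt {K : ℕ} {Z A : Finset (Fin n)} {σ : Equiv.Perm (Fin n)} (hσ : σ ∈ R)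
    (hx : x ∈ A) (h : (σ x : ℕ) < K) : x ∈ survivors K Z R A := by
  refine mem_survivors.2 ⟨hx, ?_⟩
  rintro ⟨z, -, hz⟩
  have := hz σ hσ
  rw [Fin.lt_def] at this
  omega

/-- An item outside the top `K` that is known to be preceded by all items of the top `K` is known
to be outside the top `K`. -/
theorem le_of_forall_known {K : ℕ} (hK : K ≤ n) 
    (h : ∀ y, (rank y : ℕ) < K → Known R y z) : ∀ σ ∈ R, K ≤ (σ z : ℕ) := by
  intro σ hσ
  have h1 : (Finset.univ.filter fun x => (rank x : ℕ) < K) ⊆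
      Finset.univ.filter fun x => (σ x : ℕ) < (σ z : ℕ) := by
    intro y hy
    simp only [Finset.mem_filter, Finset.mem_univ, true_and] at hy ⊢
    exact h y hy σ hσ
  have := Finset.card_le_card h1
  rwa [card_rank_lt _ hK, card_rank_lt _ (σ z).isLt.le] at this

end RoundAlg
namespace RoundAlg

variable {n : ℕ} {R : Set (Equiv.Perm (Fin n))} {rank : Equiv.Perm (Fin n)} {x y z : Fin n}

/-- The cost analysis needs survival in terms of the true order. An item of `Z` outside the top `K`
is known to be preceded by `K` items of `A`, hence known to be outside. -/
theorem mem_survivors_iff_rank {K : ℕ} {Z A : Finset (Fin n)} (hK : K ≤ n) (hR : rank ∈ R)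
    (hA : ∀ y, (rank y : ℕ) < K → y ∈ A)
    (h1 : ∀ x ∈ A, ∀ z ∈ Z, rank x < rank z → Known R x z)
    (h2 : ∀ x ∈ A, ∀ z ∈ Z, rank z < rank x → Known R z x) :
    x ∈ survivors K Z R A ↔ x ∈ A ∧ ∀ z ∈ Z, K ≤ (rank z : ℕ) → rank x ≤ rank z := by
  rw [mem_survivors]
  refine and_congr_right fun hx => ⟨fun h z hz hzK => ?_, ?_⟩
  · by_contra hlt
    refine h ⟨z, hz, fun σ hσ => ⟨?_, h2 x hx z hz (not_le.1 hlt) σ hσ⟩⟩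
    refine le_of_forall_known (rank := rank) hK (fun y hy => h1 y (hA y hy) z hz ?_) σ hσ
    rw [Fin.lt_def]
    omega
  · rintro h ⟨z, hz, hσ⟩
    exact absurd (h z hz (hσ rank hR).1) (not_le.2 (hσ rank hR).2)

/-! ### Evenly spread pivots and the cost of refining gaps -/

/-- `S` is evenly spread in the order `rank`: up to a factor `lam`, among `d` consecutive
items about `d / δ` belong to `S`. -/
structure Spread (rank : Equiv.Perm (Fin n)) (lam δ : ℝ) (S : Finset (Fin n)) : Prop where
  hit : ∀ a b : ℕ, a ≤ b → b ≤ n → lam * δ ≤ (b : ℝ) - a →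
    ∃ z ∈ S, a ≤ (rank z : ℕ) ∧ (rank z : ℕ) < b
  count : ∀ a b : ℕ, a ≤ b → b ≤ n →
    ((S.filter fun z => a ≤ (rank z : ℕ) ∧ (rank z : ℕ) < b).card : ℝ) ≤
      4 * ((b : ℝ) - a) / δ + lam

theorem card_filter_rank_le (rank : Equiv.Perm (Fin n)) (S : Finset (Fin n)) (a b : ℕ) :
    (S.filter fun z => a ≤ (rank z : ℕ) ∧ (rank z : ℕ) < b).card ≤ b - a := by
  rw [← Nat.card_Ico]
  refine Finset.card_le_card_of_injOn (fun z => (rank z : ℕ)) ?_ ?_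
  · intro z hz
    simp at hz ⊢
    exact hz.2
  · intro z _ w _ h
    exact rank.injective (Fin.ext h)

theorem spread_univ (rank : Equiv.Perm (Fin n)) {lam : ℝ} (hlam : 0 < lam) :
    Spread rank lam 1 Finset.univ := by
  constructor
  · intro a b hab hb h
    have : (a : ℝ) < b := by linarith
    have : a < b := by exact_mod_cast this
    exact ⟨rank.symm ⟨a, by omega⟩, by simp, by simp, by simpa using this⟩
  · intro a b hab hb
    have h1 := card_filter_rank_le rank Finset.univ a b
    have h2 : ((Finset.univ.filter fun z => a ≤ (rank z : ℕ) ∧ (rank z : ℕ) < b).card : ℝ) ≤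
        (b : ℝ) - a := by
      rw [← Nat.cast_sub hab]
      exact_mod_cast h1
    have h3 : (0 : ℝ) ≤ (b : ℝ) - a := by
      have : (a : ℝ) ≤ b := by exact_mod_cast hab
      linarith
    linarith

/-- Few items of a spread set lie close to `x`, in the sense that no item of another spread set
lies in between. -/
theorem Spread.card_le {lam δ δ' : ℝ} {S T W : Finset (Fin n)} (hδ : 0 < δ) (hδ' : 0 ≤ lam * δ')
    (hS : Spread rank lam δ S) (hT : Spread rank lam δ' T) (hW : W ⊆ S)
    (h1 : ∀ z ∈ W, ∀ t ∈ T, ¬ (rank x < rank t ∧ rank t < rank z))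
    (h2 : ∀ z ∈ W, ∀ t ∈ T, ¬ (rank z < rank t ∧ rank t < rank x)) :
    (W.card : ℝ) ≤ 4 * (2 * (lam * δ') + 3) / δ + lam := by
  set w := ⌈lam * δ'⌉₊ with hw
  have hw1 : (w : ℝ) < lam * δ' + 1 := Nat.ceil_lt_add_one hδ'
  have key : ∀ u v : Fin n, (∀ t ∈ T, ¬ (rank u < rank t ∧ rank t < rank v)) →
      (rank v : ℕ) ≤ rank u + w := by
    intro u v h
    by_contra hcon
    push Not at hcon
    obtain ⟨t, ht, ht1, ht2⟩ := hT.hit (rank u + 1) (rank v) (by omega) (rank v).isLt.le (by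
      have h3 : (((rank u : ℕ) + 1 + w : ℕ) : ℝ) ≤ ((rank v : ℕ) : ℝ) := by
        exact_mod_cast (by omega : (rank u : ℕ) + 1 + w ≤ rank v)
      have h4 := Nat.le_ceil (lam * δ')
      push_cast at h3 ⊢
      linarith)
    exact h t ht ⟨by rw [Fin.lt_def]; omega, by rw [Fin.lt_def]; omega⟩
  set a := (rank x : ℕ) - w with ha
  set b := min n ((rank x : ℕ) + w + 1) with hb
  have hab : a ≤ b := by
    have := (rank x).isLt
    omega
  have hsub : W ⊆ S.filter fun z => a ≤ (rank z : ℕ) ∧ (rank z : ℕ) < b := by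
    intro z hz
    have k1 := key x z (h1 z hz)
    have k2 := key z x (h2 z hz)
    have := (rank z).isLt
    exact Finset.mem_filter.2 ⟨hW hz, by omega, by omega⟩
  have h3 := hS.count a b hab (min_le_left _ _)
  have h4 : (W.card : ℝ) ≤ (S.filter fun z => a ≤ (rank z : ℕ) ∧ (rank z : ℕ) < b).card := by
    exact_mod_cast Finset.card_le_card hsub
  have h5 : (b : ℝ) - a ≤ 2 * (lam * δ') + 3 := by
    have : b ≤ a + (2 * w + 1) := by omega
    have : (b : ℝ) ≤ a + (2 * w + 1) := by exact_mod_cast this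
    linarith
  refine (h4.trans h3).trans ?_
  gcongr

/-- The numerical form of `Spread.card_le` for two consecutive levels of pivots. -/
theorem Spread.card_le_of_levels {lam ρ : ℝ} {j : ℕ} {S T W : Finset (Fin n)} (hρ : 1 ≤ ρ)
    (hlam : 1 ≤ lam) (hS : Spread rank lam (ρ ^ j) S) (hT : Spread rank lam (ρ ^ (j + 1)) T)
    (hW : W ⊆ S) (h1 : ∀ z ∈ W, ∀ t ∈ T, ¬ (rank x < rank t ∧ rank t < rank z))
    (h2 : ∀ z ∈ W, ∀ t ∈ T, ¬ (rank z < rank t ∧ rank t < rank x)) :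
    (W.card : ℝ) ≤ 21 * lam * ρ := by
  have hρj : (1 : ℝ) ≤ ρ ^ j := one_le_pow₀ hρ
  refine (Spread.card_le (by positivity) (by positivity) hS hT hW h1 h2).trans ?_
  -- The constant 21 is 8 + 12 + 1: main term, rounding of the window, additive `lam`.
  have e : 4 * (2 * (lam * ρ ^ (j + 1)) + 3) / ρ ^ j = 8 * lam * ρ + 12 / ρ ^ j := by
    field_simp
    ring
  have e2 : 12 / ρ ^ j ≤ 12 := div_le_self (by norm_num) hρj
  have e3 : lam ≤ lam * ρ := le_mul_of_one_le_right (by linarith) hρ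
  rw [e]
  nlinarith

theorem card_undecidedPairs_le {A Z : Finset (Fin n)} {c : ℝ}
    (h : ∀ x ∈ A, ∀ W : Finset (Fin n), W ⊆ Z → (∀ z ∈ W, Undecided R x z) → (W.card : ℝ) ≤ c) :
    ((undecidedPairs R A Z).card : ℝ) ≤ A.card * c := by
  classical
  have e : undecidedPairs R A Z = A.biUnion fun x =>
      (Z.filter fun z => Undecided R x z).map ⟨fun z => (x, z), Prod.mk_right_injective x⟩ := by
    ext ⟨u, v⟩
    simp only [mem_undecidedPairs, Finset.mem_biUnion, Finset.mem_map, Finset.mem_filter,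
      Function.Embedding.coeFn_mk, Prod.mk.injEq]
    constructor
    · rintro ⟨⟨h1, h2⟩, h3⟩
      exact ⟨u, h1, v, ⟨h2, h3⟩, rfl, rfl⟩
    · rintro ⟨a, h1, b, ⟨h2, h3⟩, rfl, rfl⟩
      exact ⟨⟨h1, h2⟩, h3⟩
  have h1 : (undecidedPairs R A Z).card ≤ ∑ x ∈ A, (Z.filter fun z => Undecided R x z).card := by
    rw [e]
    refine Finset.card_biUnion_le.trans (Finset.sum_le_sum fun x _ => ?_)
    rw [Finset.card_map]
  calc ((undecidedPairs R A Z).card : ℝ)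
      ≤ ∑ x ∈ A, ((Z.filter fun z => Undecided R x z).card : ℝ) := by exact_mod_cast h1
    _ ≤ ∑ x ∈ A, c := by
        refine Finset.sum_le_sum fun x hx => h x hx _ (Finset.filter_subset _ _) ?_
        intro z hz
        exact (Finset.mem_filter.1 hz).2
    _ = A.card * c := by simp

/-- The invariant `hinv` says that undecided pairs are not separated by the previous pivots. So an
item is open only against the pivots in its own gap, and the invariant passes to the next level. -/
theorem comparisons_sortWithin_le {lam ρ : ℝ} (hρ : 1 ≤ ρ) (hlam : 1 ≤ lam) {B : Finset (Fin n)}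
    (hB : ∀ x ∈ B, ∀ y, rank y < rank x → y ∈ B) {S : ℕ → Finset (Fin n)} (k m : ℕ)
    (hS : ∀ j ≤ m, Spread rank lam (ρ ^ j) (S j)) (hR : rank ∈ R)
    (hinv : ∀ x ∈ B, ∀ y ∈ B, Undecided R x y → ∀ z ∈ S m, ¬ (rank x < rank z ∧ rank z < rank y)) :
    ((sortWithin B S k m R).comparisons rank : ℝ) ≤ m * (B.card * (21 * lam * ρ)) := by
  induction m generalizing R with
  | zero => simp [sortWithin, comparisons]
  | succ m ih =>
    rw [sortWithin, comparisons_ask]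
    have h1 : ((undecidedPairs R B (S m ∩ B)).card : ℝ) ≤ B.card * (21 * lam * ρ) := by
      refine card_undecidedPairs_le fun x hx W hW hu => ?_
      refine Spread.card_le_of_levels (x := x) hρ hlam (hS m (by omega)) (hS (m + 1) le_rfl)
        (hW.trans Finset.inter_subset_left) ?_ ?_
      · intro z hz
        exact hinv x hx z (Finset.mem_inter.1 (hW hz)).2 (hu z hz)
      · intro z hz
        exact hinv z (Finset.mem_inter.1 (hW hz)).2 x hx (hu z hz).symm
    have h2 := ih (R := consistent rank (undecidedPairs R B (S m ∩ B)) R)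
      (fun j hj => hS j (by omega)) (mem_consistent hR) (by
        rintro x hx y hy hu z hz ⟨hxz, hzy⟩
        -- `B` is an initial segment, so a separating pivot lies in `B` and is decided against both
        -- items.
        have hzB : z ∈ S m ∩ B := Finset.mem_inter.2 ⟨hz, hB y hy z hzy⟩
        exact hu.1 ((known_consistent_undecidedPairs hR hx hzB hxz).trans
          (known_consistent_undecidedPairs_swap hR hy hzB hzy)))
    push_cast
    linarith

/-! ### The two algorithms and the cost of sifting -/

open Classical in
/-- The items of `S` that are known to be preceded by at most `τ` items of `S`. -/
noncomputable def topPivots (S : Finset (Fin n)) (τ : ℝ) (R : Set (Equiv.Perm (Fin n))) :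
    Finset (Fin n) :=
  S.filter fun z => ((S.filter fun w => Known R w z).card : ℝ) ≤ τ

theorem topPivots_subset {S : Finset (Fin n)} {τ : ℝ} : topPivots S τ R ⊆ S :=
  Finset.filter_subset _ _

theorem mem_topPivots {S : Finset (Fin n)} {τ : ℝ} (hR : rank ∈ R) (hz : z ∈ S)
    (h : ((S.filter fun w => rank w < rank z).card : ℝ) ≤ τ) : z ∈ topPivots S τ R := by
  classical
  refine Finset.mem_filter.2 ⟨hz, le_trans ?_ h⟩
  have : (S.filter fun w => Known R w z) ⊆ S.filter fun w => rank w < rank z := by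
    intro w hw
    rw [Finset.mem_filter] at hw ⊢
    exact ⟨hw.1, hw.2 rank hR⟩
  exact_mod_cast Finset.card_le_card this

theorem card_topPivots_le {S : Finset (Fin n)} {τ : ℝ} (hτ : 0 ≤ τ)
    (hS : ∀ x ∈ S, ∀ y ∈ S, rank x < rank y → Known R x y) :
    ((topPivots S τ R).card : ℝ) ≤ τ + 1 := by
  classical
  rcases (topPivots S τ R).eq_empty_or_nonempty with h | h
  · rw [h]; simp; linarith
  · obtain ⟨z, hz, hmax⟩ := Finset.exists_max_image _ (fun z => rank z) h
    have h1 : topPivots S τ R ⊆ insert z (S.filter fun w => Known R w z) := by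
      intro w hw
      by_cases hwz : w = z
      · simp [hwz]
      · refine Finset.mem_insert_of_mem (Finset.mem_filter.2 ⟨topPivots_subset hw, ?_⟩)
        exact hS w (topPivots_subset hw) z (topPivots_subset hz)
          (lt_of_le_of_ne (hmax w hw) fun h => hwz (rank.injective h))
    have h2 := (Finset.card_le_card h1).trans (Finset.card_insert_le _ _)
    have h3 : ((S.filter fun w => Known R w z).card : ℝ) ≤ τ := (Finset.mem_filter.1 hz).2
    have h4 : ((topPivots S τ R).card : ℝ) ≤ (S.filter fun w => Known R w z).card + 1 := by
      exact_mod_cast h2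
    linarith

/-- Compare all items with the pivots in `T` and sort `S`; then compare the survivors with the
best pivots in `S`; finally sort what survives both. -/
noncomputable def siftAndSort (T S : Finset (Fin n)) (τ : ℝ) (K : ℕ) (L : ℕ → Finset (Fin n))
    (k m : ℕ) : RoundAlg n (m + 2) :=
  ask (Finset.univ ×ˢ T ∪ S ×ˢ S) Set.univ fun R₁ =>
    ask (undecidedPairs R₁ (survivors K T R₁ Finset.univ) (topPivots S τ R₁)) R₁ fun R₂ =>
      sortWithin (survivors K (topPivots S τ R₁) R₂ (survivors K T R₁ Finset.univ)) L k m R₂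

theorem isSortedTopK_siftAndSort (rank : Equiv.Perm (Fin n)) (T S : Finset (Fin n)) (τ : ℝ)
    {K k : ℕ} (hk : k ≤ K) (hK : K ≤ n) {L : ℕ → Finset (Fin n)} (hL : L 0 = Finset.univ) (m : ℕ) :
    IsSortedTopK rank k ((siftAndSort T S τ K L k (m + 1)).result rank) := by
  rw [siftAndSort, result_ask, result_ask]
  refine isSortedTopK_sortWithin (hk.trans hK) hL m (mem_consistent (mem_consistent trivial)) ?_
  intro σ hσ x hx
  exact mem_survivors_of_lt hσ (mem_survivors_of_lt (consistent_subset hσ) (Finset.mem_univ x)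
    (hx.trans_le hk)) (hx.trans_le hk)

/-- Compare all items with the pivots in `T`, then sort the survivors. -/
noncomputable def pruneAndSort (T : Finset (Fin n)) (k : ℕ) : RoundAlg n 2 :=
  ask (Finset.univ ×ˢ T) Set.univ fun R₁ =>
    sortWithin (survivors k T R₁ Finset.univ) (fun _ => Finset.univ) k 1 R₁

theorem isSortedTopK_pruneAndSort (rank : Equiv.Perm (Fin n)) (T : Finset (Fin n)) {k : ℕ}
    (hk : k ≤ n) : IsSortedTopK rank k ((pruneAndSort T k).result rank) := by
  rw [pruneAndSort, result_ask]
  refine isSortedTopK_sortWithin hk rfl 0 (mem_consistent trivial) ?_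
  intro σ hσ x hx
  exact mem_survivors_of_lt hσ (Finset.mem_univ x) hx

theorem known_of_mem_pivots {Q : Finset (Fin n × Fin n)} {T : Finset (Fin n)}
    (hQ : Finset.univ ×ˢ T ⊆ Q) (hz : z ∈ T) (x : Fin n) (h : rank x < rank z) :
    Known (consistent rank Q R) x z :=
  known_consistent_of_mem (hQ (by simp [hz])) h

theorem known_of_mem_pivots_swap {Q : Finset (Fin n × Fin n)} {T : Finset (Fin n)}
    (hQ : Finset.univ ×ˢ T ⊆ Q) (hz : z ∈ T) (x : Fin n) (h : rank z < rank x) :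
    Known (consistent rank Q R) z x :=
  known_consistent_of_mem_swap (hQ (by simp [hz])) h

theorem mem_survivors_univ {K : ℕ} (hK : K ≤ n) {Q : Finset (Fin n × Fin n)} {T : Finset (Fin n)}
    (hQ : Finset.univ ×ˢ T ⊆ Q) (hR : rank ∈ R) :
    x ∈ survivors K T (consistent rank Q R) Finset.univ ↔
      ∀ z ∈ T, K ≤ (rank z : ℕ) → rank x ≤ rank z := by
  rw [mem_survivors_iff_rank hK (mem_consistent hR) (fun y _ => Finset.mem_univ y)
    (fun x _ z hz => known_of_mem_pivots hQ hz x) fun x _ z hz => known_of_mem_pivots_swap hQ hz x]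
  simp

theorem not_between_of_undecided {Q : Finset (Fin n × Fin n)} {T : Finset (Fin n)}
    (hQ : Finset.univ ×ˢ T ⊆ Q) (hu : Undecided (consistent rank Q R) x y) (hz : z ∈ T) :
    ¬ (rank x < rank z ∧ rank z < rank y) := fun ⟨h1, h2⟩ =>
  hu.1 ((known_of_mem_pivots hQ hz x h1).trans (known_of_mem_pivots_swap hQ hz y h2))

/-- The items of rank at least `K` that are not preceded by an item of a spread set of rank at
least `K`. -/
theorem card_le_of_spread {lam δ : ℝ} {S A : Finset (Fin n)} {K : ℕ} (hδ : 0 ≤ lam * δ)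
    (hS : Spread rank lam δ S)
    (h : ∀ x ∈ A, K ≤ (rank x : ℕ) ∧ ¬ ∃ z ∈ S, K ≤ (rank z : ℕ) ∧ rank z < rank x) :
    (A.card : ℝ) ≤ lam * δ + 1 := by
  have h1 : ∀ x ∈ A, K ≤ (rank x : ℕ) ∧ (rank x : ℕ) < K + ⌈lam * δ⌉₊ := by
    intro x hx
    refine ⟨(h x hx).1, ?_⟩
    by_contra hcon
    push Not at hcon
    obtain ⟨z, hz, h1, h2⟩ := hS.hit K (rank x) (h x hx).1 (rank x).isLt.le (by
      have h3 : ((K + ⌈lam * δ⌉₊ : ℕ) : ℝ) ≤ ((rank x : ℕ) : ℝ) := by exact_mod_cast hcon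
      have h4 := Nat.le_ceil (lam * δ)
      push_cast at h3
      linarith)
    exact (h x hx).2 ⟨z, hz, h1, h2⟩
  have h2 : A ⊆ A.filter fun z => K ≤ (rank z : ℕ) ∧ (rank z : ℕ) < K + ⌈lam * δ⌉₊ :=
    fun x hx => Finset.mem_filter.2 ⟨hx, h1 x hx⟩
  have h3 := (Finset.card_le_card h2).trans (card_filter_rank_le rank A _ _)
  have h4 : (A.card : ℝ) ≤ (⌈lam * δ⌉₊ : ℝ) := by exact_mod_cast (by omega : A.card ≤ ⌈lam * δ⌉₊)
  exact h4.trans (Nat.ceil_lt_add_one hδ).le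

theorem card_filter_rank_lt_le {K : ℕ} (hK : K ≤ n) (rank : Equiv.Perm (Fin n))
    (A : Finset (Fin n)) : (A.filter fun x => (rank x : ℕ) < K).card ≤ K := by
  refine (Finset.card_le_card (Finset.filter_subset_filter _ (Finset.subset_univ A))).trans ?_
  rw [card_rank_lt _ hK]

/-- The first two summands pay for round 1. The third pays for round 2 and for `m` rounds of sorting
at most `K + lam * ρ ^ m + 1` survivors. -/
theorem comparisons_siftAndSort_le {lam ρ : ℝ} (hρ : 1 ≤ ρ) (hlam : 1 ≤ lam) {K : ℕ} (hK : K ≤ n)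
    (k m : ℕ) {L : ℕ → Finset (Fin n)}
    (hL : ∀ j ≤ m + 1, Spread rank lam (ρ ^ j) (L j)) :
    ((siftAndSort (L (m + 1)) (L m) (4 * K / ρ ^ m + lam) K L k m).comparisons rank : ℝ) ≤
      n * (L (m + 1)).card + (L m).card ^ 2 +
        (42 * m + 33) * lam ^ 2 * (K * ρ + ρ ^ (m + 1)) := by
  set T := L (m + 1) with hT
  set S := L m with hS
  set τ : ℝ := 4 * K / ρ ^ m + lam with hτ
  have hTs := hL (m + 1) le_rfl
  have hSs := hL m (by omega)
  have hρ0 : 0 < ρ := by linarith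
  have hτ0 : 0 ≤ τ := by positivity
  rw [siftAndSort, comparisons_ask, comparisons_ask]
  set Q₁ := (Finset.univ : Finset (Fin n)) ×ˢ T ∪ S ×ˢ S with hQ₁
  have hsub : (Finset.univ : Finset (Fin n)) ×ˢ T ⊆ Q₁ := Finset.subset_union_left
  set R₁ := consistent rank Q₁ Set.univ with hR₁
  have hr₁ : rank ∈ R₁ := mem_consistent trivial
  set A := survivors K T R₁ Finset.univ with hA
  set Z := topPivots S τ R₁ with hZ
  set R₂ := consistent rank (undecidedPairs R₁ A Z) R₁ with hR₂
  have hr₂ : rank ∈ R₂ := mem_consistent hr₁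
  set B := survivors K Z R₂ A with hB
  have memA : ∀ x, x ∈ A ↔ ∀ z ∈ T, K ≤ (rank z : ℕ) → rank x ≤ rank z :=
    fun x => mem_survivors_univ hK hsub trivial
  have hAtop : ∀ y, (rank y : ℕ) < K → y ∈ A := fun y hy =>
    mem_survivors_of_lt hr₁ (Finset.mem_univ y) hy
  have memB : ∀ x, x ∈ B ↔ x ∈ A ∧ ∀ z ∈ Z, K ≤ (rank z : ℕ) → rank x ≤ rank z :=
    fun x => mem_survivors_iff_rank hK hr₂ hAtop
      (fun x hx z hz => known_consistent_undecidedPairs hr₁ hx hz)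
      (fun x hx z hz => known_consistent_undecidedPairs_swap hr₁ hx hz)
  have hBA : B ⊆ A := fun x hx => ((memB x).1 hx).1
  have hBdown : ∀ x ∈ B, ∀ y, rank y < rank x → y ∈ B := by
    intro x hx y hy
    rw [memB, memA] at hx ⊢
    exact ⟨fun z hz h => hy.le.trans (hx.1 z hz h), fun z hz h => hy.le.trans (hx.2 z hz h)⟩
  -- The choice of `τ`: it bounds the number of items of `S` in the top `K`, so these and the next
  -- item of `S` all belong to `Z`.
  have htop : ((S.filter fun w => (rank w : ℕ) < K).card : ℝ) ≤ τ := by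
    have := hSs.count 0 K (Nat.zero_le _) hK
    simpa using this
  -- the best item of `S` outside the top `K` is a pivot
  have hZlow : ∀ z ∈ S, (rank z : ℕ) < K → z ∈ Z := by
    intro z hz hzK
    refine mem_topPivots hr₁ hz (le_trans ?_ htop)
    refine Nat.cast_le.2 (Finset.card_le_card fun w hw => ?_)
    rw [Finset.mem_filter] at hw ⊢
    refine ⟨hw.1, ?_⟩
    have := hw.2
    rw [Fin.lt_def] at this
    omega
  have hZhigh : ∀ z ∈ S, K ≤ (rank z : ℕ) → ∃ w ∈ Z, K ≤ (rank w : ℕ) ∧ rank w ≤ rank z := by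
    intro z hz hzK
    obtain ⟨w, hw, hmin⟩ := Finset.exists_min_image (S.filter fun w => K ≤ (rank w : ℕ))
      (fun w => rank w) ⟨z, Finset.mem_filter.2 ⟨hz, hzK⟩⟩
    rw [Finset.mem_filter] at hw
    refine ⟨w, mem_topPivots hr₁ hw.1 (le_trans ?_ htop), hw.2,
      hmin z (Finset.mem_filter.2 ⟨hz, hzK⟩)⟩
    refine Nat.cast_le.2 (Finset.card_le_card fun v hv => ?_)
    rw [Finset.mem_filter] at hv ⊢
    refine ⟨hv.1, ?_⟩
    by_contra hcon
    exact absurd (hmin v (Finset.mem_filter.2 ⟨hv.1, not_lt.1 hcon⟩)) (not_le.2 hv.2)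
  have hBS : ∀ x ∈ B, ∀ z ∈ S, K ≤ (rank z : ℕ) → rank x ≤ rank z := by
    intro x hx z hz hzK
    obtain ⟨w, hw, hwK, hwz⟩ := hZhigh z hz hzK
    exact (((memB x).1 hx).2 w hw hwK).trans hwz
  -- A pivot of `S` strictly before an item of `B` has rank below `K`, so it is in `Z` and decided
  -- against all of `A`.
  have hinv : ∀ x ∈ B, ∀ y ∈ B, Undecided R₂ x y → ∀ z ∈ S,
      ¬ (rank x < rank z ∧ rank z < rank y) := by
    rintro x hx y hy hu z hz ⟨hxz, hzy⟩
    have hzZ : z ∈ Z := by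
      refine hZlow z hz ?_
      by_contra hcon
      exact absurd (hBS y hy z hz (not_lt.1 hcon)) (not_le.2 hzy)
    exact hu.1 ((known_consistent_undecidedPairs hr₁ (hBA hx) hzZ hxz).trans
      (known_consistent_undecidedPairs_swap hr₁ (hBA hy) hzZ hzy))
  have hBcard : (B.card : ℝ) ≤ K + (lam * ρ ^ m + 1) := by
    rw [← Finset.card_filter_add_card_filter_not (s := B) (p := fun x => (rank x : ℕ) < K)]
    push_cast
    refine add_le_add (by exact_mod_cast card_filter_rank_lt_le hK rank B) ?_
    refine card_le_of_spread (K := K) (by positivity) hSs fun x hx => ?_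
    rw [Finset.mem_filter] at hx
    refine ⟨not_lt.1 hx.2, ?_⟩
    rintro ⟨z, hz, hzK, hzx⟩
    exact absurd (hBS x hx.1 z hz hzK) (not_le.2 hzx)
  have c3 := comparisons_sortWithin_le hρ hlam hBdown k m (fun j hj => hL j (by omega)) hr₂ hinv
  have c1 : (Q₁.card : ℝ) ≤ n * T.card + S.card ^ 2 := by
    have : Q₁.card ≤ n * T.card + S.card ^ 2 := by
      refine (Finset.card_union_le _ _).trans ?_
      rw [Finset.card_product, Finset.card_product, Finset.card_univ, Fintype.card_fin, sq]
    exact_mod_cast this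
  -- the second round
  have hZcard : (Z.card : ℝ) ≤ τ + 1 := by
    refine card_topPivots_le (rank := rank) hτ0 fun x hx y hy h => ?_
    exact known_consistent_of_mem (Finset.mem_union_right _ (Finset.mk_mem_product hx hy)) h
  -- Top-`K` items are charged by gaps of `T`. The others may far outnumber `K`, so they are charged
  -- by the size of `Z` instead.
  set A' := A.filter fun x => (rank x : ℕ) < K with hA'
  set A'' := A.filter fun x => ¬ (rank x : ℕ) < K with hA''
  have c2a : ((undecidedPairs R₁ A' Z).card : ℝ) ≤ A'.card * (21 * lam * ρ) := by
    refine card_undecidedPairs_le fun x hx W hW hu => ?_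
    refine Spread.card_le_of_levels (x := x) hρ hlam hSs hTs (hW.trans topPivots_subset) ?_ ?_
    · intro z hz t ht
      exact not_between_of_undecided hsub (hu z hz) ht
    · intro z hz t ht
      exact not_between_of_undecided hsub (hu z hz).symm ht
  have c2b : ((undecidedPairs R₁ A'' Z).card : ℝ) ≤ A''.card * (τ + 1) := by
    refine card_undecidedPairs_le fun x hx W hW hu => le_trans ?_ hZcard
    exact_mod_cast Finset.card_le_card hW
  have cA' : (A'.card : ℝ) ≤ K := by exact_mod_cast card_filter_rank_lt_le hK rank A
  have cA'' : (A''.card : ℝ) ≤ lam * ρ ^ (m + 1) + 1 := by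
    refine card_le_of_spread (K := K) (by positivity) hTs fun x hx => ?_
    rw [Finset.mem_filter] at hx
    refine ⟨not_lt.1 hx.2, ?_⟩
    rintro ⟨z, hz, hzK, hzx⟩
    exact absurd ((memA x).1 hx.1 z hz hzK) (not_le.2 hzx)
  have c2 : ((undecidedPairs R₁ A Z).card : ℝ) ≤
      (undecidedPairs R₁ A' Z).card + (undecidedPairs R₁ A'' Z).card := by
    have : undecidedPairs R₁ A Z ⊆ undecidedPairs R₁ A' Z ∪ undecidedPairs R₁ A'' Z := by
      rintro ⟨x, z⟩ hxz
      rw [mem_undecidedPairs] at hxz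
      rw [Finset.mem_union, mem_undecidedPairs, mem_undecidedPairs, Finset.mem_filter,
        Finset.mem_filter]
      tauto
    exact_mod_cast (Finset.card_le_card this).trans (Finset.card_union_le _ _)
  have hp : (1 : ℝ) ≤ ρ ^ m := one_le_pow₀ hρ
  have hps : ρ ^ (m + 1) = ρ ^ m * ρ := pow_succ ρ m
  have hl2 : lam ≤ lam ^ 2 := by nlinarith
  have hKρ : (0 : ℝ) ≤ K * ρ := by positivity
  have d1 : (A'.card : ℝ) * (21 * lam * ρ) ≤ 21 * lam ^ 2 * (K * ρ) := by
    calc (A'.card : ℝ) * (21 * lam * ρ) ≤ K * (21 * lam * ρ) := by gcongr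
      _ = 21 * lam * (K * ρ) := by ring
      _ ≤ _ := by gcongr
  have d2 : (A''.card : ℝ) * (τ + 1) ≤ 8 * lam ^ 2 * (K * ρ) + 4 * lam ^ 2 * ρ ^ (m + 1) := by
    have hp' : 1 ≤ ρ ^ (m + 1) := one_le_pow₀ hρ
    calc (A''.card : ℝ) * (τ + 1) ≤ (2 * (lam * ρ ^ (m + 1))) * (4 * K / ρ ^ m + 2 * lam) := by
          refine mul_le_mul ?_ ?_ (by linarith) (by positivity)
          · nlinarith
          · rw [hτ]; linarith
      _ = 8 * lam * (K * ρ) + 4 * lam ^ 2 * ρ ^ (m + 1) := by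
          rw [hps]; field_simp; ring
      _ ≤ _ := by gcongr
  have d3 : (m : ℝ) * (B.card * (21 * lam * ρ)) ≤
      42 * m * lam ^ 2 * (K * ρ + ρ ^ (m + 1)) := by
    calc (m : ℝ) * (B.card * (21 * lam * ρ))
        ≤ m * ((K + 2 * (lam * ρ ^ m)) * (21 * lam * ρ)) := by
          gcongr
          nlinarith
      _ = m * (21 * lam * (K * ρ) + 42 * lam ^ 2 * ρ ^ (m + 1)) := by rw [hps]; ring
      _ ≤ m * (42 * lam ^ 2 * (K * ρ) + 42 * lam ^ 2 * ρ ^ (m + 1)) := by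
          gcongr; norm_num
      _ = _ := by ring
  have d4 : 0 ≤ lam ^ 2 * (K * ρ) := by positivity
  have d5 : 0 ≤ lam ^ 2 * ρ ^ (m + 1) := by positivity
  -- 33 covers 21 + 8 for `K * ρ` and 4 for `ρ ^ (m + 1)`.
  push_cast
  nlinarith

end RoundAlg
-- Expected cost under a uniform random seed
namespace RandomizedRoundAlg

variable {n r : ℕ}

/-- The randomized algorithm that runs `D ω` for a uniformly random `ω`. -/
noncomputable def uniform {Ω : Type} [Fintype Ω] [Nonempty Ω] (D : Ω → RoundAlg n r) :
    RandomizedRoundAlg n r :=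
  (PMF.uniformOfFintype Ω).map D

theorem alwaysSolvesSortedTopK_uniform {Ω : Type} [Fintype Ω] [Nonempty Ω] {D : Ω → RoundAlg n r}
    {k : ℕ} (h : ∀ ω rank, IsSortedTopK rank k ((D ω).result rank)) :
    (uniform D).AlwaysSolvesSortedTopK k := by
  intro D' hD' rank
  obtain ⟨ω, -, rfl⟩ := (PMF.mem_support_map_iff _ _ _).1 hD'
  exact h ω rank

theorem expectedComparisons_uniform {Ω : Type} [Fintype Ω] [Nonempty Ω] (D : Ω → RoundAlg n r)
    (rank : Equiv.Perm (Fin n)) :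
    (uniform D).expectedComparisons rank =
      ∑ ω, (Fintype.card Ω : ℝ≥0∞)⁻¹ * ((D ω).comparisons rank : ℝ≥0∞) := by
  classical
  simp only [expectedComparisons, uniform, PMF.map_apply, PMF.uniformOfFintype_apply]
  simp_rw [tsum_fintype, Finset.sum_mul]
  rw [Summable.tsum_finsetSum fun _ _ => ENNReal.summable]
  refine Finset.sum_congr rfl fun ω _ => ?_
  rw [tsum_eq_single (D ω)]
  · simp
  · intro D' hD'
    simp [hD']

theorem expectedComparisons_uniform_le {Ω : Type} [Fintype Ω] [Nonempty Ω]
    {D : Ω → RoundAlg n r} {rank : Equiv.Perm (Fin n)} {B : ℝ}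
    (h : ∑ ω, ((D ω).comparisons rank : ℝ) ≤ Fintype.card Ω * B) :
    (uniform D).expectedComparisons rank ≤ ENNReal.ofReal B := by
  have hpos : (0 : ℝ) < Fintype.card Ω := by exact_mod_cast Fintype.card_pos
  rw [expectedComparisons_uniform, ← Finset.mul_sum, mul_comm, ← div_eq_mul_inv]
  refine ENNReal.div_le_of_le_mul ?_
  have e1 : (Fintype.card Ω : ℝ≥0∞) = ENNReal.ofReal (Fintype.card Ω) := by simp
  have e2 : ∑ ω, ((D ω).comparisons rank : ℝ≥0∞) =
      ENNReal.ofReal (∑ ω, ((D ω).comparisons rank : ℝ)) := by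
    rw [ENNReal.ofReal_sum_of_nonneg fun _ _ => Nat.cast_nonneg _]
    simp
  rw [e1, e2, mul_comm, ← ENNReal.ofReal_mul hpos.le]
  exact ENNReal.ofReal_le_ofReal h

end RandomizedRoundAlg

/-! ### Random samples are spread -/

namespace RoundAlg

variable {n N : ℕ}

/-- The set of the first `s` items of the sequence `ω`. -/
def sample (s : ℕ) (ω : Fin N → Fin n) : Finset (Fin n) :=
  (Finset.univ.filter fun j : Fin N => (j : ℕ) < s).image ω

theorem card_sample_le (s : ℕ) (ω : Fin N → Fin n) : (sample s ω).card ≤ s := by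
  refine Finset.card_image_le.trans ?_
  rw [Fin.card_filter_val_lt]
  exact min_le_right _ _

/-- The sum factors over the coordinates, and `1 + x ≤ exp x`. With `w = 0` it counts the sequences
avoiding `G`, as `0 ^ 0 = 1`; with `w = e` it yields a Chernoff bound. -/
theorem sum_pow_card_le (hn : 0 < n) {s : ℕ} (hs : s ≤ N) (G : Finset (Fin n)) {w : ℝ}
    (hw : 0 ≤ w) :
    ∑ ω : Fin N → Fin n, w ^ (Finset.univ.filter fun j : Fin N => (j : ℕ) < s ∧ ω j ∈ G).card ≤
      (n : ℝ) ^ N * Real.exp ((w - 1) * (G.card * s / n)) := by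
  have hn' : (0 : ℝ) < n := by exact_mod_cast hn
  have hG : (G.card : ℝ) ≤ n := by
    have := Finset.card_le_univ G
    rw [Fintype.card_fin] at this
    exact_mod_cast this
  have e1 : ∀ ω : Fin N → Fin n, w ^ (Finset.univ.filter fun j : Fin N => (j : ℕ) < s ∧ ω j ∈ G).card =
      ∏ j : Fin N, (if (j : ℕ) < s ∧ ω j ∈ G then w else 1) := by
    intro ω
    rw [Finset.prod_ite, Finset.prod_const, Finset.prod_const_one, mul_one]
  have e2 : ∀ j : Fin N, ∑ v : Fin n, (if (j : ℕ) < s ∧ v ∈ G then w else 1) =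
      if (j : ℕ) < s then (n : ℝ) + (w - 1) * G.card else n := by
    intro j
    by_cases hj : (j : ℕ) < s
    · have : ∀ v : Fin n, (if (j : ℕ) < s ∧ v ∈ G then w else 1) =
          1 + if v ∈ G then w - 1 else 0 := by
        intro v
        by_cases hv : v ∈ G <;> simp [hj, hv]
      simp only [this, Finset.sum_add_distrib, if_pos hj]
      simp
      ring
    · simp [hj]
  have e3 : ∑ ω : Fin N → Fin n, ∏ j : Fin N, (if (j : ℕ) < s ∧ ω j ∈ G then w else 1) =
      ∏ j : Fin N, ∑ v : Fin n, (if (j : ℕ) < s ∧ v ∈ G then w else 1) := by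
    rw [Finset.prod_univ_sum, Fintype.piFinset_univ]
  simp_rw [e1]
  rw [e3]
  simp_rw [e2]
  have e4 : ∏ j : Fin N, (if (j : ℕ) < s then (n : ℝ) + (w - 1) * G.card else n) =
      (n : ℝ) ^ N * (1 + (w - 1) * (G.card / n)) ^ s := by
    have : ∀ j : Fin N, (if (j : ℕ) < s then (n : ℝ) + (w - 1) * G.card else n) =
        n * if (j : ℕ) < s then 1 + (w - 1) * (G.card / n) else 1 := by
      intro j
      split_ifs
      · field_simp
      · simp
    simp_rw [this]
    rw [Finset.prod_mul_distrib, Finset.prod_const, Finset.prod_ite, Finset.prod_const,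
      Finset.prod_const_one, mul_one, Fin.card_filter_val_lt, min_eq_right hs]
    simp
  rw [e4]
  gcongr
  have h0 : 0 ≤ 1 + (w - 1) * (G.card / n) := by
    have h1 : (G.card : ℝ) / n ≤ 1 := (div_le_one hn').2 hG
    have h2 : 0 ≤ (G.card : ℝ) / n := by positivity
    nlinarith
  calc (1 + (w - 1) * (G.card / n)) ^ s ≤ Real.exp ((w - 1) * (G.card / n)) ^ s := by
        gcongr
        rw [add_comm]
        exact Real.add_one_le_exp _
    _ = Real.exp ((w - 1) * (G.card * s / n)) := by
        rw [← Real.exp_nat_mul]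
        congr 1
        ring

theorem card_avoid_le (hn : 0 < n) {s : ℕ} (hs : s ≤ N) (G : Finset (Fin n)) :
    ((Finset.univ.filter fun ω : Fin N → Fin n => ∀ z ∈ sample s ω, z ∉ G).card : ℝ) ≤
      (n : ℝ) ^ N * Real.exp (-(G.card * s / n)) := by
  have h := sum_pow_card_le hn hs G (le_refl (0 : ℝ))
  rw [zero_sub, neg_one_mul] at h
  refine le_trans ?_ h
  rw [Finset.natCast_card_filter]
  refine Finset.sum_le_sum fun ω _ => ?_
  split_ifs with hω
  · have : (Finset.univ.filter fun j : Fin N => (j : ℕ) < s ∧ ω j ∈ G) = ∅ := by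
      refine Finset.filter_eq_empty_iff.2 fun j _ hj => ?_
      exact hω (ω j) (Finset.mem_image_of_mem _ (by simpa using hj.1)) hj.2
    rw [this]
    simp
  · positivity

theorem card_crowded_le (hn : 0 < n) {s : ℕ} (hs : s ≤ N) (G : Finset (Fin n)) (a : ℝ) :
    ((Finset.univ.filter fun ω : Fin N → Fin n =>
      a < (((sample s ω).filter fun z => z ∈ G).card : ℝ)).card : ℝ) ≤
      (n : ℝ) ^ N * Real.exp (2 * (G.card * s / n) - a) := by
  have h := sum_pow_card_le hn hs G (Real.exp_pos 1).le
  have h2 : ((Finset.univ.filter fun ω : Fin N → Fin n =>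
      a < (((sample s ω).filter fun z => z ∈ G).card : ℝ)).card : ℝ) ≤
      ∑ ω : Fin N → Fin n,
        Real.exp 1 ^ (Finset.univ.filter fun j : Fin N => (j : ℕ) < s ∧ ω j ∈ G).card * Real.exp (-a) := by
    rw [Finset.natCast_card_filter]
    refine Finset.sum_le_sum fun ω _ => ?_
    split_ifs with hω
    · have h1 : ((sample s ω).filter fun z => z ∈ G).card ≤
          (Finset.univ.filter fun j : Fin N => (j : ℕ) < s ∧ ω j ∈ G).card := by
        refine le_trans (Finset.card_le_card ?_) (Finset.card_image_le (f := ω))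
        intro z hz
        rw [Finset.mem_filter, sample, Finset.mem_image] at hz
        obtain ⟨⟨j, hj, rfl⟩, hjG⟩ := hz
        exact Finset.mem_image_of_mem _ (by simpa [hjG] using hj)
      have h3 : (((sample s ω).filter fun z => z ∈ G).card : ℝ) ≤
          (Finset.univ.filter fun j : Fin N => (j : ℕ) < s ∧ ω j ∈ G).card := by exact_mod_cast h1
      rw [← Real.exp_nat_mul, ← Real.exp_add]
      exact Real.one_le_exp (by linarith)
    · positivity
  rw [← Finset.sum_mul] at h2
  refine h2.trans ?_
  calc _ ≤ (n : ℝ) ^ N * Real.exp ((Real.exp 1 - 1) * (G.card * s / n)) * Real.exp (-a) := by gcongr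
    _ = (n : ℝ) ^ N * Real.exp ((Real.exp 1 - 1) * (G.card * s / n) - a) := by
        rw [mul_assoc, ← Real.exp_add, ← sub_eq_add_neg]
    _ ≤ _ := by
        have := Real.exp_one_lt_d9
        gcongr
        linarith

theorem card_rank_Ico (rank : Equiv.Perm (Fin n)) {a b : ℕ} (hb : b ≤ n) :
    (Finset.univ.filter fun z => a ≤ (rank z : ℕ) ∧ (rank z : ℕ) < b).card = b - a := by
  rcases le_total a b with hab | hab
  · have h1 : (Finset.univ.filter fun z => a ≤ (rank z : ℕ) ∧ (rank z : ℕ) < b) =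
        (Finset.univ.filter fun z => (rank z : ℕ) < b) \
          Finset.univ.filter fun z => (rank z : ℕ) < a := by
      ext z
      simp
      omega
    rw [h1, Finset.card_sdiff_of_subset, card_rank_lt _ hb, card_rank_lt _ (hab.trans hb)]
    intro z
    simp
    omega
  · rw [Nat.sub_eq_zero_of_le hab, Finset.card_eq_zero, Finset.filter_eq_empty_iff]
    intro z _
    omega

-- Union bound over at most `(n + 1) ^ 2` windows, each failing in either way with probability at
-- most `exp (-lam)`. Since `n ≤ s * δ`, a window of length `lam * δ` expects `lam` hits. Since `s *
-- δ ≤ 2 * n`, the Chernoff term `2 * d * s / n` for length `d` is at most `4 * d / δ`, whence the 4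
-- in `Spread`.
open Classical in
theorem card_not_spread_le (hn : 0 < n) (rank : Equiv.Perm (Fin n)) {s : ℕ} (hs : s ≤ N)
    {lam δ : ℝ} (hδ : 0 < δ) (h1 : (n : ℝ) ≤ s * δ) (h2 : s * δ ≤ 2 * n) :
    ((Finset.univ.filter fun ω : Fin N → Fin n => ¬ Spread rank lam δ (sample s ω)).card : ℝ) ≤
      (n : ℝ) ^ N * (2 * (n + 1) ^ 2 * Real.exp (-lam)) := by
  have hn' : (0 : ℝ) < n := by exact_mod_cast hn
  let G : ℕ → ℕ → Finset (Fin n) := fun a b =>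
    Finset.univ.filter fun z => a ≤ (rank z : ℕ) ∧ (rank z : ℕ) < b
  let I : Finset (ℕ × ℕ) := (Finset.range (n + 1) ×ˢ Finset.range (n + 1)).filter fun p => p.1 ≤ p.2
  let E₁ : ℕ × ℕ → Finset (Fin N → Fin n) := fun p => Finset.univ.filter fun ω =>
    lam * δ ≤ (p.2 : ℝ) - p.1 ∧ ∀ z ∈ sample s ω, z ∉ G p.1 p.2
  let E₂ : ℕ × ℕ → Finset (Fin N → Fin n) := fun p => Finset.univ.filter fun ω =>
    4 * ((p.2 : ℝ) - p.1) / δ + lam < (((sample s ω).filter fun z => z ∈ G p.1 p.2).card : ℝ)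
  have hsub : (Finset.univ.filter fun ω : Fin N → Fin n => ¬ Spread rank lam δ (sample s ω)) ⊆
      I.biUnion fun p => E₁ p ∪ E₂ p := by
    intro ω hω
    rw [Finset.mem_filter] at hω
    by_contra hcon
    refine hω.2 ⟨fun a b hab hb h => ?_, fun a b hab hb => ?_⟩
    · by_contra hno
      refine hcon (Finset.mem_biUnion.2 ⟨(a, b), ?_, Finset.mem_union_left _ ?_⟩)
      · simp [I]; omega
      · simp only [E₁, G, Finset.mem_filter, Finset.mem_univ, true_and]
        exact ⟨h, fun z hz hz2 => hno ⟨z, hz, hz2⟩⟩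
    · by_contra hno
      refine hcon (Finset.mem_biUnion.2 ⟨(a, b), ?_, Finset.mem_union_right _ ?_⟩)
      · simp [I]; omega
      · simp only [E₂, G, Finset.mem_filter, Finset.mem_univ, true_and]
        exact not_le.1 hno
  have hE : ∀ p ∈ I, ((E₁ p ∪ E₂ p).card : ℝ) ≤ (n : ℝ) ^ N * (2 * Real.exp (-lam)) := by
    rintro ⟨a, b⟩ hp
    simp only [I, Finset.mem_filter, Finset.mem_product, Finset.mem_range] at hp
    have hb : b ≤ n := by omega
    have hG : ((G a b).card : ℝ) = (b : ℝ) - a := by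
      rw [← Nat.cast_sub hp.2]
      exact_mod_cast card_rank_Ico rank hb
    have hE1 : ((E₁ (a, b)).card : ℝ) ≤ (n : ℝ) ^ N * Real.exp (-lam) := by
      by_cases hlen : lam * δ ≤ (b : ℝ) - a
      · refine le_trans ?_ ((card_avoid_le hn hs (G a b)).trans ?_)
        · refine Nat.cast_le.2 (Finset.card_le_card fun ω hω => ?_)
          rw [Finset.mem_filter] at hω ⊢
          exact ⟨hω.1, hω.2.2⟩
        · gcongr
          rw [hG, le_div_iff₀ hn']
          have h0 : 0 ≤ (b : ℝ) - a := by rw [← hG]; positivity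
          rcases le_total lam 0 with hl | hl
          · have : 0 ≤ ((b : ℝ) - a) * s := by positivity
            nlinarith
          · calc lam * n ≤ lam * (s * δ) := by gcongr
              _ = (lam * δ) * s := by ring
              _ ≤ _ := by gcongr
      · have : E₁ (a, b) = ∅ := by
          refine Finset.filter_eq_empty_iff.2 fun ω _ h => hlen h.1
        rw [this]
        simp
        positivity
    have hE2 : ((E₂ (a, b)).card : ℝ) ≤ (n : ℝ) ^ N * Real.exp (-lam) := by
      refine (card_crowded_le hn hs (G a b) _).trans ?_
      gcongr
      have h0 : 0 ≤ (b : ℝ) - a := by rw [← hG]; positivity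
      have : ((b : ℝ) - a) * s / n ≤ 2 * (((b : ℝ) - a) / δ) := by
        rw [div_le_iff₀ hn', mul_div_assoc']
        rw [div_mul_eq_mul_div, le_div_iff₀ hδ]
        nlinarith
      have h4 : 4 * ((b : ℝ) - a) / δ = 4 * (((b : ℝ) - a) / δ) := mul_div_assoc _ _ _
      rw [hG]
      simp only
      rw [h4]
      linarith
    have := Finset.card_union_le (E₁ (a, b)) (E₂ (a, b))
    have : ((E₁ (a, b) ∪ E₂ (a, b)).card : ℝ) ≤ (E₁ (a, b)).card + (E₂ (a, b)).card := by
      exact_mod_cast this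
    linarith
  have hI : (I.card : ℝ) ≤ (n + 1) ^ 2 := by
    have h1 : I.card ≤ (n + 1) * (n + 1) := by
      refine (Finset.card_filter_le _ _).trans ?_
      simp
    rw [sq]
    exact_mod_cast h1
  calc ((Finset.univ.filter fun ω : Fin N → Fin n => ¬ Spread rank lam δ (sample s ω)).card : ℝ)
      ≤ ∑ p ∈ I, ((E₁ p ∪ E₂ p).card : ℝ) := by
        exact_mod_cast (Finset.card_le_card hsub).trans Finset.card_biUnion_le
    _ ≤ ∑ _p ∈ I, (n : ℝ) ^ N * (2 * Real.exp (-lam)) := Finset.sum_le_sum hE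
    _ = I.card * ((n : ℝ) ^ N * (2 * Real.exp (-lam))) := by simp
    _ ≤ (n + 1) ^ 2 * ((n : ℝ) ^ N * (2 * Real.exp (-lam))) := by gcongr
    _ = _ := by ring

end RoundAlg
-- Two rounds: expected number of open pairs
namespace RoundAlg

variable {n N : ℕ}

theorem sum_geom_shift_le {q : ℝ} (h0 : 0 ≤ q) (h1 : q < 1) (a n : ℕ) :
    ∑ b ∈ Finset.range n, (if a ≤ b then q ^ (b - a) else 0) ≤ (1 - q)⁻¹ := by
  rw [← Finset.sum_filter]
  have : (Finset.range n).filter (fun b => a ≤ b) = Finset.Ico a n := by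
    ext b
    simp
    omega
  rw [this, Finset.sum_Ico_eq_sum_range]
  simp only [Nat.add_sub_cancel_left]
  exact (Summable.sum_le_tsum _ (fun i _ => by positivity)
    (summable_geometric_of_lt_one h0 h1)).trans (tsum_geometric_of_lt_one h0 h1).le

/-- Here `a`, `b` are the ranks of a pair. If `a < k`, the exponent is 0 both at `b = a` (truncated)
and at `b = a + 1`, whence the extra 1. If `k ≤ a`, then `q ^ (b - k) = q ^ (b - a) * q ^ (a - k)`,
whence the square. -/
theorem sum_geom_pairs_le {q : ℝ} (h0 : 0 ≤ q) (h1 : q < 1) {k n : ℕ} (hk : k ≤ n) :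
    ∑ a ∈ Finset.range n, ∑ b ∈ Finset.range n,
      (if a ≤ b then (if a < k then q ^ (b - a - 1) else q ^ (b - k)) else 0) ≤
    k * (1 + (1 - q)⁻¹) + (1 - q)⁻¹ ^ 2 := by
  have hG : 0 ≤ (1 - q)⁻¹ := by
    rw [inv_nonneg]
    linarith
  have hrow : ∀ a, ∑ b ∈ Finset.range n,
      (if a ≤ b then (if a < k then q ^ (b - a - 1) else q ^ (b - k)) else 0) ≤
      (if a < k then 1 + (1 - q)⁻¹ else 0) +
        (1 - q)⁻¹ * (if k ≤ a then q ^ (a - k) else 0) := by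
    intro a
    by_cases ha : a < k
    · simp only [ha, if_true, not_le.2 ha, if_false, mul_zero, add_zero]
      calc ∑ b ∈ Finset.range n, (if a ≤ b then q ^ (b - a - 1) else 0)
          ≤ ∑ b ∈ Finset.range n, ((if b = a then 1 else 0) +
              (if a + 1 ≤ b then q ^ (b - (a + 1)) else 0)) := by
            refine Finset.sum_le_sum fun b _ => ?_
            rcases lt_trichotomy a b with h | h | h
            · rw [if_pos h.le, if_pos (Nat.succ_le_of_lt h), if_neg h.ne', zero_add]
              rw [Nat.sub_sub]
            · subst h
              simp
            · rw [if_neg (not_le.2 h)]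
              positivity
        _ ≤ _ := by
            rw [Finset.sum_add_distrib]
            refine add_le_add ?_ (sum_geom_shift_le h0 h1 _ _)
            rw [Finset.sum_ite_eq']
            split_ifs <;> norm_num
    · have ha' : k ≤ a := not_lt.1 ha
      simp only [ha, if_false, ha', if_true, zero_add]
      calc ∑ b ∈ Finset.range n, (if a ≤ b then q ^ (b - k) else 0)
          = (∑ b ∈ Finset.range n, (if a ≤ b then q ^ (b - a) else 0)) * q ^ (a - k) := by
            rw [Finset.sum_mul]
            refine Finset.sum_congr rfl fun b _ => ?_
            split_ifs with h
            · rw [← pow_add]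
              congr 1
              omega
            · simp
        _ ≤ _ := by
            gcongr
            exact sum_geom_shift_le h0 h1 _ _
  refine (Finset.sum_le_sum fun a _ => hrow a).trans ?_
  rw [Finset.sum_add_distrib, ← Finset.mul_sum, sq]
  refine add_le_add ?_ (mul_le_mul_of_nonneg_left (sum_geom_shift_le h0 h1 _ _) hG)
  rw [← Finset.sum_filter, Finset.sum_const, nsmul_eq_mul]
  have : (Finset.range n).filter (fun a => a < k) = Finset.range k := by
    ext a
    simp
    omega
  rw [this, Finset.card_range]

/-- The items `x`, `y` are not separated by `T` in the order `rank`, nor cut off by an item of `T`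
outside the top `k`. -/
def Close (rank : Equiv.Perm (Fin n)) (k : ℕ) (T : Finset (Fin n)) (x y : Fin n) : Prop :=
  rank x ≤ rank y ∧
    ((rank x : ℕ) < k ∧ (∀ z ∈ T, ¬ (rank x < rank z ∧ rank z < rank y)) ∨
      k ≤ (rank x : ℕ) ∧ ∀ z ∈ T, ¬ (k ≤ (rank z : ℕ) ∧ rank z < rank y))

open Classical in
theorem comparisons_pruneAndSort_le (rank : Equiv.Perm (Fin n)) (T : Finset (Fin n)) {k : ℕ}
    (hk : k ≤ n) :
    (pruneAndSort T k).comparisons rank ≤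
      n * T.card + 2 * (Finset.univ.filter fun p : Fin n × Fin n => Close rank k T p.1 p.2).card := by
  rw [pruneAndSort, comparisons_ask, sortWithin, comparisons_ask, sortWithin, comparisons, add_zero,
    Finset.card_product, Finset.card_univ, Fintype.card_fin]
  refine Nat.add_le_add_left ?_ _
  set E := Finset.univ.filter fun p : Fin n × Fin n => Close rank k T p.1 p.2 with hE
  have hsub : ((Finset.univ : Finset (Fin n)) ×ˢ T) ⊆ Finset.univ ×ˢ T := subset_rfl
  have key : undecidedPairs (consistent rank (Finset.univ ×ˢ T) Set.univ)
      (survivors k T (consistent rank (Finset.univ ×ˢ T) Set.univ) Finset.univ)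
      (Finset.univ ∩ survivors k T (consistent rank (Finset.univ ×ˢ T) Set.univ) Finset.univ) ⊆
      E ∪ E.image Prod.swap := by
    -- By symmetry only `rank x ≤ rank y` is treated, at the price of the factor 2. Equality is
    -- included because diagonal pairs count as undecided.
    have main : ∀ x y : Fin n, rank x ≤ rank y →
        y ∈ survivors k T (consistent rank (Finset.univ ×ˢ T) Set.univ) Finset.univ →
        Undecided (consistent rank (Finset.univ ×ˢ T) Set.univ) x y → (x, y) ∈ E := by
      intro x y hxy hy hu
      rw [mem_survivors_univ hk hsub (Set.mem_univ _)] at hy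
      refine Finset.mem_filter.2 ⟨Finset.mem_univ _, hxy, ?_⟩
      rcases lt_or_ge (rank x : ℕ) k with h | h
      · exact Or.inl ⟨h, fun z hz => not_between_of_undecided hsub hu hz⟩
      · exact Or.inr ⟨h, fun z hz hzz => absurd (hy z hz hzz.1) (not_le.2 hzz.2)⟩
    rintro ⟨x, y⟩ hxy
    rw [mem_undecidedPairs, Finset.univ_inter] at hxy
    rw [Finset.mem_union]
    rcases le_total (rank x) (rank y) with h | h
    · exact Or.inl (main x y h hxy.1.2 hxy.2)
    · exact Or.inr (Finset.mem_image.2 ⟨(y, x), main y x h hxy.1.1 hxy.2.symm, rfl⟩)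
  refine (Finset.card_le_card key).trans ((Finset.card_union_le _ _).trans ?_)
  have := Finset.card_image_le (s := E) (f := Prod.swap)
  omega

-- Closeness forces the sample to avoid the items strictly between `x` and `y`, or those from rank
-- `k` up to just before `y`.
open Classical in
theorem card_close_le (hn : 0 < n) (rank : Equiv.Perm (Fin n)) {s : ℕ} (hs : s ≤ N) (k : ℕ)
    (x y : Fin n) :
    ((Finset.univ.filter fun ω : Fin N → Fin n => Close rank k (sample s ω) x y).card : ℝ) ≤
      (n : ℝ) ^ N * (if (rank x : ℕ) ≤ rank y then (if (rank x : ℕ) < k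
        then Real.exp (-(s / n)) ^ ((rank y : ℕ) - rank x - 1)
        else Real.exp (-(s / n)) ^ ((rank y : ℕ) - k)) else 0) := by
  have avoid : ∀ a : ℕ, (∀ ω : Fin N → Fin n, Close rank k (sample s ω) x y →
      ∀ z ∈ sample s ω, ¬ (a ≤ (rank z : ℕ) ∧ (rank z : ℕ) < rank y)) →
      ((Finset.univ.filter fun ω : Fin N → Fin n => Close rank k (sample s ω) x y).card : ℝ) ≤
      (n : ℝ) ^ N * Real.exp (-(s / n)) ^ ((rank y : ℕ) - a) := by
    intro a h
    have h1 := card_avoid_le hn hs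
      (Finset.univ.filter fun z => a ≤ (rank z : ℕ) ∧ (rank z : ℕ) < rank y)
    rw [card_rank_Ico rank (rank y).isLt.le] at h1
    rw [← Real.exp_nat_mul]
    refine le_trans (Nat.cast_le.2 (Finset.card_le_card fun ω hω => ?_)) (h1.trans (le_of_eq ?_))
    · rw [Finset.mem_filter] at hω ⊢
      refine ⟨hω.1, fun z hz => ?_⟩
      simpa using h ω hω.2 z hz
    · congr 2
      ring
  split_ifs with h1 h2
  · rw [Nat.sub_sub]
    refine avoid _ fun ω hω z hz hzz => ?_
    rcases hω.2 with h | h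
    · exact h.2 z hz ⟨by rw [Fin.lt_def]; omega, by rw [Fin.lt_def]; omega⟩
    · omega
  · refine avoid _ fun ω hω z hz hzz => ?_
    rcases hω.2 with h | h
    · omega
    · exact h.2 z hz ⟨hzz.1, by rw [Fin.lt_def]; omega⟩
  · have : (Finset.univ.filter fun ω : Fin N → Fin n => Close rank k (sample s ω) x y) = ∅ :=
      Finset.filter_eq_empty_iff.2 fun ω _ h => h1 h.1
    rw [this]
    simp

theorem sum_comparisons_pruneAndSort_le (hn : 0 < n) (rank : Equiv.Perm (Fin n)) {s : ℕ}
    (hs0 : 0 < s) (hs : s ≤ N) {k : ℕ} (hk : k ≤ n) :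
    ∑ ω : Fin N → Fin n, ((pruneAndSort (sample s ω) k).comparisons rank : ℝ) ≤
      (n : ℝ) ^ N * (n * s + 2 * (k * (2 + n / s) + (1 + n / s) ^ 2)) := by
  classical
  have hn' : (0 : ℝ) < n := by exact_mod_cast hn
  have hs' : (0 : ℝ) < s := by exact_mod_cast hs0
  set q := Real.exp (-((s : ℝ) / n)) with hq
  have hα : 0 < (s : ℝ) / n := by positivity
  have hq1 : q < 1 := by
    rw [hq, Real.exp_lt_one_iff]
    linarith
  have hG : (1 - q)⁻¹ ≤ 1 + n / s := by
    have h1 : q ≤ (1 + (s : ℝ) / n)⁻¹ := by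
      rw [hq, Real.exp_neg]
      refine inv_anti₀ (by positivity) ?_
      rw [add_comm]
      exact Real.add_one_le_exp _
    have h2 : (1 + (n : ℝ) / s)⁻¹ ≤ 1 - q := by
      have : (1 + (n : ℝ) / s)⁻¹ = 1 - (1 + (s : ℝ) / n)⁻¹ := by
        field_simp
        ring
      linarith
    exact inv_le_of_inv_le₀ (by positivity) h2
  have hpairs : ∑ ω : Fin N → Fin n, ((Finset.univ.filter fun p : Fin n × Fin n =>
      Close rank k (sample s ω) p.1 p.2).card : ℝ) ≤
      (n : ℝ) ^ N * (k * (1 + (1 - q)⁻¹) + (1 - q)⁻¹ ^ 2) := by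
    have e1 : ∑ ω : Fin N → Fin n, ((Finset.univ.filter fun p : Fin n × Fin n =>
        Close rank k (sample s ω) p.1 p.2).card : ℝ) = ∑ x : Fin n, ∑ y : Fin n,
        ((Finset.univ.filter fun ω : Fin N → Fin n => Close rank k (sample s ω) x y).card : ℝ) := by
      simp_rw [Finset.natCast_card_filter, Fintype.sum_prod_type]
      rw [Finset.sum_comm]
      exact Finset.sum_congr rfl fun x _ => Finset.sum_comm
    rw [e1]
    refine (Finset.sum_le_sum fun x _ => Finset.sum_le_sum fun y _ =>
      card_close_le hn rank hs k x y).trans ?_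
    simp_rw [← Finset.mul_sum]
    refine mul_le_mul_of_nonneg_left ?_ (by positivity)
    refine le_trans (le_of_eq ?_) (sum_geom_pairs_le (Real.exp_pos _).le hq1 hk)
    rw [← Fin.sum_univ_eq_sum_range (fun a => ∑ b ∈ Finset.range n,
      (if a ≤ b then (if a < k then q ^ (b - a - 1) else q ^ (b - k)) else 0))]
    refine Eq.trans ?_ (Equiv.sum_comp rank _)
    refine Finset.sum_congr rfl fun x _ => ?_
    rw [← Fin.sum_univ_eq_sum_range (fun b => if (rank x : ℕ) ≤ b then
      (if (rank x : ℕ) < k then q ^ (b - rank x - 1) else q ^ (b - k)) else 0)]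
    exact (Equiv.sum_comp rank (fun b : Fin n => if (rank x : ℕ) ≤ b then
      (if (rank x : ℕ) < k then q ^ ((b : ℕ) - rank x - 1) else q ^ ((b : ℕ) - k)) else 0))
  have hω : ∀ ω : Fin N → Fin n, ((pruneAndSort (sample s ω) k).comparisons rank : ℝ) ≤
      n * s + 2 * ((Finset.univ.filter fun p : Fin n × Fin n =>
        Close rank k (sample s ω) p.1 p.2).card : ℝ) := by
    intro ω
    have h1 := comparisons_pruneAndSort_le rank (sample s ω) hk
    have h2 := Nat.mul_le_mul_left n (card_sample_le s ω)
    exact_mod_cast h1.trans (Nat.add_le_add_right h2 _)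
  refine (Finset.sum_le_sum fun ω _ => hω ω).trans ?_
  rw [Finset.sum_add_distrib, Finset.sum_const, nsmul_eq_mul, ← Finset.mul_sum]
  have hc : ((Finset.univ : Finset (Fin N → Fin n)).card : ℝ) = (n : ℝ) ^ N := by simp
  rw [hc]
  have hG0 : 0 ≤ (1 - q)⁻¹ := by
    rw [inv_nonneg]
    linarith
  calc (n : ℝ) ^ N * (n * s) + 2 * ∑ ω : Fin N → Fin n, ((Finset.univ.filter fun p : Fin n × Fin n =>
        Close rank k (sample s ω) p.1 p.2).card : ℝ)
      ≤ (n : ℝ) ^ N * (n * s) +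
        2 * ((n : ℝ) ^ N * (k * (1 + (1 - q)⁻¹) + (1 - q)⁻¹ ^ 2)) := by gcongr
    _ ≤ (n : ℝ) ^ N * (n * s) +
        2 * ((n : ℝ) ^ N * (k * (1 + (1 + n / s)) + (1 + n / s) ^ 2)) := by gcongr
    _ = _ := by ring

end RoundAlg

namespace RandomizedRoundAlg

/-- With no items there is nothing to do. -/
theorem exists_alg_zero (r k : ℕ) (hk : k ≤ 0) (B : ℝ) :
    ∃ A : RandomizedRoundAlg 0 r, A.AlwaysSolvesSortedTopK k ∧
      ∀ rank, A.expectedComparisons rank ≤ ENNReal.ofReal B := by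
  obtain rfl : k = 0 := by omega
  have hex : ∀ r : ℕ, Nonempty (RoundAlg 0 r) := by
    intro r
    induction r with
    | zero => exact ⟨.output []⟩
    | succ r ih => exact ⟨.round ∅ fun _ => ih.some⟩
  obtain ⟨D⟩ := hex r
  refine ⟨uniform fun _ : Unit => D, alwaysSolvesSortedTopK_uniform ?_, fun rank => ?_⟩
  · intro _ rank
    have : D.result rank = [] := List.eq_nil_iff_forall_not_mem.2 fun x => x.elim0
    rw [this]
    exact ⟨rfl, List.Pairwise.nil, fun x => x.elim0⟩
  · have h1 : D.comparisons rank = 0 := by simpa using D.comparisons_le rank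
    rw [expectedComparisons_uniform]
    simp [h1]

theorem exists_alg_two_rounds (n k : ℕ) (hk : k ≤ n) :
    ∃ A : RandomizedRoundAlg n 2, A.AlwaysSolvesSortedTopK k ∧
      ∀ rank, A.expectedComparisons rank ≤
        ENNReal.ofReal (15 * ((n : ℝ) * Real.sqrt k + (n : ℝ) ^ ((4 : ℝ) / 3))) := by
  rcases Nat.eq_zero_or_pos n with rfl | hn
  · exact exists_alg_zero 2 k hk _
  have hn' : (0 : ℝ) < n := by exact_mod_cast hn
  have hn1 : (1 : ℝ) ≤ n := by exact_mod_cast hn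
  set u : ℝ := (n : ℝ) ^ ((1 : ℝ) / 3) with hu
  have hu1 : 1 ≤ u := Real.one_le_rpow hn1 (by norm_num)
  have hu3 : u ^ 3 = n := by
    rw [hu, ← Real.rpow_natCast, ← Real.rpow_mul hn'.le]
    norm_num
  have hu4 : (n : ℝ) ^ ((4 : ℝ) / 3) = u ^ 4 := by
    rw [hu, ← Real.rpow_natCast, ← Real.rpow_mul hn'.le]
    norm_num
  set w : ℝ := Real.sqrt k with hw
  have hw0 : 0 ≤ w := Real.sqrt_nonneg _
  have hw2 : w * w = k := Real.mul_self_sqrt (Nat.cast_nonneg k)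
  -- `s ≥ √k` turns `k * n / s` into `n * √k`, and `s ≥ n ^ (1/3)` turns `(n / s) ^ 2` into `n ^
  -- (4/3)`.
  set s : ℕ := ⌈w⌉₊ + ⌈u⌉₊ with hs
  have hs1 : w + u ≤ s := by
    rw [hs]
    push_cast
    exact add_le_add (Nat.le_ceil _) (Nat.le_ceil _)
  have hs2 : (s : ℝ) ≤ w + u + 2 := by
    rw [hs]
    push_cast
    linarith [Nat.ceil_lt_add_one hw0, Nat.ceil_lt_add_one (by linarith : 0 ≤ u)]
  have hs' : (0 : ℝ) < s := by linarith
  have hs0 : 0 < s := by exact_mod_cast hs'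
  have : Nonempty (Fin n) := ⟨⟨0, hn⟩⟩
  refine ⟨uniform fun ω : Fin s → Fin n => RoundAlg.pruneAndSort (RoundAlg.sample s ω) k,
    alwaysSolvesSortedTopK_uniform fun ω rank => RoundAlg.isSortedTopK_pruneAndSort rank _ hk,
    fun rank => expectedComparisons_uniform_le ?_⟩
  refine (RoundAlg.sum_comparisons_pruneAndSort_le hn rank hs0 le_rfl hk).trans ?_
  have hc : (Fintype.card (Fin s → Fin n) : ℝ) = (n : ℝ) ^ s := by simp
  rw [hc, hu4]
  refine mul_le_mul_of_nonneg_left ?_ (by positivity)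
  have hkn : (k : ℝ) ≤ n := by exact_mod_cast hk
  have a1 : (n : ℝ) * s ≤ n * w + 3 * u ^ 4 := by
    calc (n : ℝ) * s ≤ n * (w + 3 * u) := by
          gcongr
          linarith
      _ = n * w + 3 * u ^ 4 := by rw [← hu3]; ring
  have a2 : (k : ℝ) * (n / s) ≤ n * w := by
    rw [mul_div_assoc', div_le_iff₀ hs']
    calc (k : ℝ) * n = n * w * w := by rw [← hw2]; ring
      _ ≤ n * w * s := by
        gcongr
        linarith
  have a3 : (n : ℝ) / s ≤ u ^ 2 := by
    rw [div_le_iff₀ hs']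
    calc (n : ℝ) = u ^ 2 * u := by rw [← hu3]; ring
      _ ≤ u ^ 2 * s := by
        gcongr
        linarith
  have a4 : (1 + (n : ℝ) / s) ^ 2 ≤ 4 * u ^ 4 := by
    have : 1 ≤ u ^ 2 := one_le_pow₀ hu1
    calc (1 + (n : ℝ) / s) ^ 2 ≤ (2 * u ^ 2) ^ 2 := by
          gcongr
          linarith
      _ = _ := by ring
  have a5 : (k : ℝ) ≤ u ^ 4 := by
    calc (k : ℝ) ≤ u ^ 3 := by rw [hu3]; exact hkn
      _ ≤ u ^ 4 := pow_le_pow_right₀ hu1 (by norm_num)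
  have a6 : 0 ≤ (n : ℝ) * w := by positivity
  -- The multiples of `u ^ 4` add up to 3 + 4 + 8 = 15.
  nlinarith

end RandomizedRoundAlg
-- At least three rounds: choice of parameters
namespace RoundAlg

variable {n : ℕ}

/-- Choice of the cut-off `K` and of the ratio `ρ` between the sizes of consecutive levels of
pivots for an algorithm with `m + 2` rounds. -/
theorem exists_cutoff_ratio (hn : 0 < n) {k : ℕ} (hk : k ≤ n) (m : ℕ) :
    ∃ (K : ℕ) (ρ : ℝ), k ≤ K ∧ K ≤ n ∧ 1 ≤ ρ ∧ (K : ℝ) * ρ ^ (m + 2) = (n : ℝ) ^ 2 ∧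
      ρ ^ (m + 1) ≤ n ∧ (K : ℝ) * ρ ≤ 2 * ((n : ℝ) ^ ((2 : ℝ) / ((m + 2 : ℕ) : ℝ)) *
        (k : ℝ) ^ ((((m + 2 : ℕ) : ℝ) - 1) / ((m + 2 : ℕ) : ℝ)) + n) := by
  have hn' : (0 : ℝ) < n := by exact_mod_cast hn
  have hn1 : (1 : ℝ) ≤ n := by exact_mod_cast hn
  set r : ℝ := ((m + 2 : ℕ) : ℝ) with hr
  have hr2 : r = (m : ℝ) + 2 := by rw [hr]; push_cast; ring
  have hm0 : (0 : ℝ) ≤ m := Nat.cast_nonneg m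
  have hr0 : 0 < r := by linarith
  have hr1 : 0 < r - 1 := by linarith
  -- For `ρ = (n ^ 2 / K) ^ (1 / r)`, the condition `ρ ^ (r - 1) ≤ n` is equivalent to `v ≤ K`.
  set v : ℝ := (n : ℝ) ^ ((r - 2) / (r - 1)) with hv
  have hv1 : 1 ≤ v := Real.one_le_rpow hn1 (div_nonneg (by linarith) hr1.le)
  have hvn : v ≤ n := by
    calc v ≤ (n : ℝ) ^ (1 : ℝ) :=
          Real.rpow_le_rpow_of_exponent_le hn1 ((div_le_one hr1).2 (by linarith))
      _ = n := Real.rpow_one _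
  set K : ℕ := max k ⌈v⌉₊ with hK
  have hKv : v ≤ K := (Nat.le_ceil v).trans (by exact_mod_cast le_max_right _ _)
  have hKn : K ≤ n := max_le hk (Nat.ceil_le.2 hvn)
  have hK1 : (1 : ℝ) ≤ K := hv1.trans hKv
  have hK0 : (0 : ℝ) < K := by linarith
  have hKn' : (K : ℝ) ≤ n := by exact_mod_cast hKn
  have hbase : 1 ≤ (n : ℝ) ^ 2 / K := by
    rw [le_div_iff₀ hK0]
    nlinarith
  have hbase0 : 0 ≤ (n : ℝ) ^ 2 / K := by linarith
  refine ⟨K, ((n : ℝ) ^ 2 / K) ^ (1 / r), le_max_left _ _, hKn,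
    Real.one_le_rpow hbase (by positivity), ?_, ?_, ?_⟩
  · rw [← Real.rpow_natCast, ← hr, ← Real.rpow_mul hbase0, one_div_mul_cancel hr0.ne',
      Real.rpow_one]
    field_simp
  · have h1 : (n : ℝ) ^ 2 / K ≤ (n : ℝ) ^ (r / (r - 1)) := by
      have h2 : (n : ℝ) ^ (r / (r - 1)) * v = (n : ℝ) ^ 2 := by
        rw [hv, ← Real.rpow_add hn', ← Real.rpow_natCast]
        congr 1
        field_simp
        push_cast
        ring
      rw [div_le_iff₀ hK0, ← h2]
      gcongr
    have e : ((m + 1 : ℕ) : ℝ) = r - 1 := by rw [hr2]; push_cast; ring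
    rw [← Real.rpow_natCast, ← Real.rpow_mul hbase0, e]
    calc ((n : ℝ) ^ 2 / K) ^ (1 / r * (r - 1))
        ≤ ((n : ℝ) ^ (r / (r - 1))) ^ (1 / r * (r - 1)) := by gcongr
      _ = n := by
          rw [← Real.rpow_mul hn'.le]
          have : r / (r - 1) * (1 / r * (r - 1)) = 1 := by field_simp
          rw [this, Real.rpow_one]
  · have e1 : (K : ℝ) * ((n : ℝ) ^ 2 / K) ^ (1 / r) =
        (n : ℝ) ^ (2 / r) * (K : ℝ) ^ ((r - 1) / r) := by
      rw [Real.div_rpow (by positivity) hK0.le, ← Real.rpow_natCast, ← Real.rpow_mul hn'.le]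
      have e2 : (K : ℝ) ^ ((r - 1) / r) = K / (K : ℝ) ^ (1 / r) := by
        have : (r - 1) / r = 1 - 1 / r := by field_simp
        rw [this, Real.rpow_sub hK0, Real.rpow_one]
      rw [e2]
      have e3 : ((2 : ℕ) : ℝ) * (1 / r) = 2 / r := by push_cast; ring
      rw [e3]
      ring
    rw [e1]
    have hpos : 0 ≤ (n : ℝ) ^ (2 / r) * (k : ℝ) ^ ((r - 1) / r) := by positivity
    rcases le_total ⌈v⌉₊ k with h | h
    · have : K = k := max_eq_left h
      rw [this]
      linarith
    -- Raising the cut-off is harmless, since `n ^ (2 / r) * v ^ ((r - 1) / r) = n`.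
    · have hKe : K = ⌈v⌉₊ := max_eq_right h
      have hK2 : (K : ℝ) ≤ 2 * v := by
        rw [hKe]
        linarith [Nat.ceil_lt_add_one (by linarith : 0 ≤ v)]
      have hexp : (r - 1) / r ≤ 1 := (div_le_one hr0).2 (by linarith)
      have hexp0 : 0 ≤ (r - 1) / r := by positivity
      have h2 : (K : ℝ) ^ ((r - 1) / r) ≤ 2 * (n : ℝ) ^ ((r - 2) / r) := by
        calc (K : ℝ) ^ ((r - 1) / r) ≤ (2 * v) ^ ((r - 1) / r) := by gcongr
          _ = (2 : ℝ) ^ ((r - 1) / r) * v ^ ((r - 1) / r) :=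
              Real.mul_rpow (by norm_num) (by linarith)
          _ ≤ (2 : ℝ) ^ (1 : ℝ) * v ^ ((r - 1) / r) := by
              gcongr
              norm_num
          _ = 2 * (n : ℝ) ^ ((r - 2) / r) := by
              rw [Real.rpow_one, hv, ← Real.rpow_mul hn'.le]
              congr 2
              field_simp
      calc (n : ℝ) ^ (2 / r) * (K : ℝ) ^ ((r - 1) / r)
          ≤ (n : ℝ) ^ (2 / r) * (2 * (n : ℝ) ^ ((r - 2) / r)) := by gcongr
        _ = 2 * ((n : ℝ) ^ (2 / r) * (n : ℝ) ^ ((r - 2) / r)) := by ring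
        _ = 2 * n := by
            rw [← Real.rpow_add hn']
            have : 2 / r + (r - 2) / r = 1 := by field_simp; ring
            rw [this, Real.rpow_one]
        _ ≤ _ := by linarith

/-- The levels of pivots: all items at level `0`, and about `n / ρ ^ j` random items at
level `j`. -/
noncomputable def level (ρ : ℝ) (ω : Fin n → Fin n) (j : ℕ) : Finset (Fin n) :=
  if j = 0 then Finset.univ else sample ⌈(n : ℝ) / ρ ^ j⌉₊ ω

theorem card_level_le {ρ : ℝ} (hρ : 1 ≤ ρ) {j : ℕ} (hj : ρ ^ j ≤ n) (ω : Fin n → Fin n) :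
    ((level ρ ω j).card : ℝ) ≤ 2 * (n / ρ ^ j) := by
  have hpos : 0 < ρ ^ j := by positivity
  unfold level
  split_ifs with h
  · subst h
    simp
    linarith [(Nat.cast_nonneg n : (0 : ℝ) ≤ n)]
  · have h1 : ((sample ⌈(n : ℝ) / ρ ^ j⌉₊ ω).card : ℝ) ≤ ⌈(n : ℝ) / ρ ^ j⌉₊ := by
      exact_mod_cast card_sample_le _ ω
    have h2 := Nat.ceil_lt_add_one (by positivity : 0 ≤ (n : ℝ) / ρ ^ j)
    have h3 : 1 ≤ (n : ℝ) / ρ ^ j := (one_le_div hpos).2 hj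
    linarith

open Classical in
theorem card_not_spread_levels_le (hn : 0 < n) (rank : Equiv.Perm (Fin n)) {ρ lam : ℝ}
    (hρ : 1 ≤ ρ) (hlam : 0 < lam) {m : ℕ} (hm : ρ ^ (m + 1) ≤ n) :
    ((Finset.univ.filter fun ω : Fin n → Fin n =>
      ¬ ∀ j ≤ m + 1, Spread rank lam (ρ ^ j) (level ρ ω j)).card : ℝ) ≤
      (m + 1) * ((n : ℝ) ^ n * (2 * (n + 1) ^ 2 * Real.exp (-lam))) := by
  have hsub : (Finset.univ.filter fun ω : Fin n → Fin n =>
      ¬ ∀ j ≤ m + 1, Spread rank lam (ρ ^ j) (level ρ ω j)) ⊆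
      (Finset.Icc 1 (m + 1)).biUnion fun j => Finset.univ.filter fun ω =>
        ¬ Spread rank lam (ρ ^ j) (sample ⌈(n : ℝ) / ρ ^ j⌉₊ ω) := by
    intro ω hω
    have hω := (Finset.mem_filter.1 hω).2
    push Not at hω
    obtain ⟨j, hj, hns⟩ := hω
    have hj0 : j ≠ 0 := by
      -- Level 0 is not sampled, since the last round needs all items; it is always spread.
      rintro rfl
      rw [level, if_pos rfl, pow_zero] at hns
      exact hns (spread_univ rank hlam)
    rw [level, if_neg hj0] at hns
    exact Finset.mem_biUnion.2 ⟨j, Finset.mem_Icc.2 ⟨Nat.one_le_iff_ne_zero.2 hj0, hj⟩,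
      Finset.mem_filter.2 ⟨Finset.mem_univ _, hns⟩⟩
  have hj : ∀ j ∈ Finset.Icc 1 (m + 1), ((Finset.univ.filter fun ω : Fin n → Fin n =>
      ¬ Spread rank lam (ρ ^ j) (sample ⌈(n : ℝ) / ρ ^ j⌉₊ ω)).card : ℝ) ≤
      (n : ℝ) ^ n * (2 * (n + 1) ^ 2 * Real.exp (-lam)) := by
    intro j hj
    have hpos : 0 < ρ ^ j := by positivity
    have hone : 1 ≤ ρ ^ j := one_le_pow₀ hρ
    have hjn : ρ ^ j ≤ n := (pow_le_pow_right₀ hρ (Finset.mem_Icc.1 hj).2).trans hm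
    refine card_not_spread_le hn rank (Nat.ceil_le.2 (div_le_self (Nat.cast_nonneg n) hone)) hpos
      ((div_le_iff₀ hpos).1 (Nat.le_ceil _)) ?_
    calc (⌈(n : ℝ) / ρ ^ j⌉₊ : ℝ) * ρ ^ j ≤ ((n : ℝ) / ρ ^ j + 1) * ρ ^ j := by
          gcongr
          exact (Nat.ceil_lt_add_one (by positivity)).le
      _ = n + ρ ^ j := by field_simp
      _ ≤ 2 * n := by linarith
  calc ((Finset.univ.filter fun ω : Fin n → Fin n =>
      ¬ ∀ j ≤ m + 1, Spread rank lam (ρ ^ j) (level ρ ω j)).card : ℝ)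
      ≤ ∑ j ∈ Finset.Icc 1 (m + 1), ((Finset.univ.filter fun ω : Fin n → Fin n =>
        ¬ Spread rank lam (ρ ^ j) (sample ⌈(n : ℝ) / ρ ^ j⌉₊ ω)).card : ℝ) := by
        exact_mod_cast (Finset.card_le_card hsub).trans Finset.card_biUnion_le
    _ ≤ ∑ _j ∈ Finset.Icc 1 (m + 1), (n : ℝ) ^ n * (2 * (n + 1) ^ 2 * Real.exp (-lam)) :=
        Finset.sum_le_sum hj
    _ = _ := by simp

theorem comparisons_siftAndSort_level_le (rank : Equiv.Perm (Fin n)) {ρ Λ : ℝ}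
    (hρ : 1 ≤ ρ) (hΛ : 1 ≤ Λ) {m : ℕ} (hm0 : 1 ≤ m) (hm : ρ ^ (m + 1) ≤ n) {K : ℕ} (hK : K ≤ n)
    (hKρ : (K : ℝ) * ρ ^ (m + 2) = (n : ℝ) ^ 2) (k : ℕ) {ω : Fin n → Fin n}
    (hω : ∀ j ≤ m + 1, Spread rank (4 * Λ) (ρ ^ j) (level ρ ω j)) :
    ((siftAndSort (level ρ ω (m + 1)) (level ρ ω m) (4 * K / ρ ^ m + 4 * Λ) K (level ρ ω)
      k m).comparisons rank : ℝ) ≤ (16 * (42 * m + 33) + 6) * Λ ^ 2 * (K * ρ + n) := by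
  refine (comparisons_siftAndSort_le hρ (by linarith) hK k m hω).trans ?_
  have hρ0 : 0 < ρ := by linarith
  have hn0 : (0 : ℝ) ≤ n := Nat.cast_nonneg n
  have hM : (n : ℝ) ^ 2 / ρ ^ (m + 1) = K * ρ := by
    rw [← hKρ, pow_succ ρ (m + 1)]
    field_simp
  have hmn : ρ ^ m ≤ n := (pow_le_pow_right₀ hρ (Nat.le_succ m)).trans hm
  have h1 : (n : ℝ) * (level ρ ω (m + 1)).card ≤ 2 * (K * ρ) := by
    calc (n : ℝ) * (level ρ ω (m + 1)).card ≤ n * (2 * (n / ρ ^ (m + 1))) := by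
          gcongr
          exact card_level_le hρ hm ω
      _ = 2 * ((n : ℝ) ^ 2 / ρ ^ (m + 1)) := by ring
      _ = _ := by rw [hM]
  have h2 : ((level ρ ω m).card : ℝ) ^ 2 ≤ 4 * (K * ρ) := by
    calc ((level ρ ω m).card : ℝ) ^ 2 ≤ (2 * (n / ρ ^ m)) ^ 2 := by
          gcongr
          exact card_level_le hρ hmn ω
      _ = 4 * ((n : ℝ) ^ 2 / ρ ^ (m * 2)) := by
          rw [pow_mul]
          ring
      -- Sorting `S` at once is affordable because `m + 1 ≤ 2 * m`; this uses `m ≥ 1`, that is, at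
      -- least three rounds.
      _ ≤ 4 * ((n : ℝ) ^ 2 / ρ ^ (m + 1)) := by
          gcongr
          omega
      _ = _ := by rw [hM]
  have hX : 0 ≤ K * ρ := by positivity
  have hΛ2 : 1 ≤ Λ ^ 2 := one_le_pow₀ hΛ
  -- 6 = 2 + 4 comes from round 1; the 16 below is the square of the 4 in `4 * Λ`.
  have h3 : 6 * (K * ρ) ≤ 6 * Λ ^ 2 * (K * ρ + n) := by nlinarith
  have h4 : (42 * m + 33) * (4 * Λ) ^ 2 * (K * ρ + ρ ^ (m + 1)) ≤
      16 * (42 * m + 33) * Λ ^ 2 * (K * ρ + n) := by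
    calc (42 * m + 33) * (4 * Λ) ^ 2 * (K * ρ + ρ ^ (m + 1))
        ≤ (42 * m + 33) * (4 * Λ) ^ 2 * (K * ρ + n) := by gcongr
      _ = _ := by ring
  linarith

end RoundAlg

/-! ### At least three rounds: expected cost -/

namespace RandomizedRoundAlg

open RoundAlg in
theorem exists_alg_of_three_le_rounds (m : ℕ) (hm : 1 ≤ m) (n k : ℕ) (hk : k ≤ n) :
    ∃ A : RandomizedRoundAlg n (m + 2), A.AlwaysSolvesSortedTopK k ∧
      ∀ rank, A.expectedComparisons rank ≤ ENNReal.ofReal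
        (3 * (16 * (42 * m + 33) + 6 + 8 * (m + 1) * (m + 2)) *
          ((n : ℝ) ^ ((2 : ℝ) / ((m + 2 : ℕ) : ℝ)) *
            (k : ℝ) ^ ((((m + 2 : ℕ) : ℝ) - 1) / ((m + 2 : ℕ) : ℝ)) + (n : ℝ)) *
          (1 + Real.log n) ^ 2) := by
  classical
  rcases Nat.eq_zero_or_pos n with rfl | hn
  · exact exists_alg_zero (m + 2) k hk _
  have hn' : (0 : ℝ) < n := by exact_mod_cast hn
  have hn1 : (1 : ℝ) ≤ n := by exact_mod_cast hn
  obtain ⟨K, ρ, hkK, hKn, hρ, hKρ, hρn, hbound⟩ := exists_cutoff_ratio hn hk m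
  set X : ℝ := (n : ℝ) ^ ((2 : ℝ) / ((m + 2 : ℕ) : ℝ)) *
    (k : ℝ) ^ ((((m + 2 : ℕ) : ℝ) - 1) / ((m + 2 : ℕ) : ℝ)) with hX
  set Λ : ℝ := 1 + Real.log n with hΛ
  have hΛ1 : 1 ≤ Λ := by linarith [Real.log_nonneg hn1]
  have : Nonempty (Fin n) := ⟨⟨0, hn⟩⟩
  let D : (Fin n → Fin n) → RoundAlg n (m + 2) := fun ω =>
    siftAndSort (level ρ ω (m + 1)) (level ρ ω m) (4 * K / ρ ^ m + 4 * Λ) K (level ρ ω) k m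
  refine ⟨uniform D, alwaysSolvesSortedTopK_uniform fun ω rank => ?_,
    fun rank => expectedComparisons_uniform_le ?_⟩
  · obtain ⟨m', rfl⟩ := Nat.exists_eq_add_of_le' hm
    exact isSortedTopK_siftAndSort rank _ _ _ hkK hKn (by simp [level]) m'
  set c : ℝ := 16 * (42 * m + 33) + 6 with hc
  set Bad := Finset.univ.filter fun ω : Fin n → Fin n =>
    ¬ ∀ j ≤ m + 1, Spread rank (4 * Λ) (ρ ^ j) (level ρ ω j) with hBad
  -- The spread parameter `4 * Λ` is chosen so that `exp (-(4 * Λ)) ≤ n ^ (-4)` absorbs both the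
  -- number of windows and the worst-case `n ^ 2` comparisons per round.
  have hcard : (Bad.card : ℝ) * n ^ 2 ≤ (n : ℝ) ^ n * (8 * (m + 1)) := by
    have h1 := card_not_spread_levels_le hn rank hρ (by linarith : 0 < 4 * Λ) hρn
    have h2 : Real.exp (-(4 * Λ)) * (n : ℝ) ^ 4 ≤ 1 := by
      have h3 : (n : ℝ) ^ 4 = Real.exp (4 * Real.log n) := by
        rw [show (4 : ℝ) * Real.log n = ((4 : ℕ) : ℝ) * Real.log n by norm_num, Real.exp_nat_mul,
          Real.exp_log hn']
      rw [h3, ← Real.exp_add, Real.exp_le_one_iff]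
      linarith
    have h4 : ((n : ℝ) + 1) ^ 2 ≤ 4 * (n : ℝ) ^ 2 := by nlinarith
    calc (Bad.card : ℝ) * n ^ 2
        ≤ (m + 1) * ((n : ℝ) ^ n * (2 * (n + 1) ^ 2 * Real.exp (-(4 * Λ)))) * n ^ 2 := by gcongr
      _ ≤ (m + 1) * ((n : ℝ) ^ n * (2 * (4 * (n : ℝ) ^ 2) * Real.exp (-(4 * Λ)))) * n ^ 2 := by
          gcongr
      _ = (n : ℝ) ^ n * (8 * (m + 1)) * (Real.exp (-(4 * Λ)) * (n : ℝ) ^ 4) := by ring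
      _ ≤ (n : ℝ) ^ n * (8 * (m + 1)) * 1 := by gcongr
      _ = _ := mul_one _
  have hω : ∀ ω, ((D ω).comparisons rank : ℝ) ≤ c * Λ ^ 2 * (K * ρ + n) +
      if ¬ ∀ j ≤ m + 1, Spread rank (4 * Λ) (ρ ^ j) (level ρ ω j)
        then (m + 2) * (n : ℝ) ^ 2 else 0 := by
    intro ω
    by_cases h : ¬ ∀ j ≤ m + 1, Spread rank (4 * Λ) (ρ ^ j) (level ρ ω j)
    · rw [if_pos h]
      have h1 : ((D ω).comparisons rank : ℝ) ≤ (m + 2) * (n : ℝ) ^ 2 := by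
        rw [sq]
        exact_mod_cast (D ω).comparisons_le rank
      have h2 : 0 ≤ c * Λ ^ 2 * (K * ρ + n) := by positivity
      linarith
    · rw [if_neg h, add_zero]
      exact comparisons_siftAndSort_level_le rank hρ hΛ1 hm hρn hKn hKρ k (not_not.1 h)
  have hcΩ : (Fintype.card (Fin n → Fin n) : ℝ) = (n : ℝ) ^ n := by simp
  have hsum : ∑ ω, ((D ω).comparisons rank : ℝ) ≤
      (n : ℝ) ^ n * (c * Λ ^ 2 * (K * ρ + n)) + Bad.card * ((m + 2) * (n : ℝ) ^ 2) := by
    refine (Finset.sum_le_sum fun ω _ => hω ω).trans (le_of_eq ?_)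
    rw [Finset.sum_add_distrib, Finset.sum_const, Finset.card_univ, nsmul_eq_mul, hcΩ,
      ← Finset.sum_filter, Finset.sum_const, nsmul_eq_mul]
  refine hsum.trans ?_
  rw [hcΩ]
  have hX0 : 0 ≤ X := by positivity
  have hΛ2 : 1 ≤ Λ ^ 2 := one_le_pow₀ hΛ1
  have hbad : (Bad.card : ℝ) * ((m + 2) * (n : ℝ) ^ 2) ≤
      (n : ℝ) ^ n * (8 * (m + 1) * (m + 2)) := by
    calc (Bad.card : ℝ) * ((m + 2) * (n : ℝ) ^ 2) = (m + 2) * (Bad.card * (n : ℝ) ^ 2) := by ring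
      _ ≤ (m + 2) * ((n : ℝ) ^ n * (8 * (m + 1))) := by gcongr
      _ = _ := by ring
  have hone : 1 ≤ Λ ^ 2 * (3 * (X + n)) := by nlinarith
  -- `K * ρ + n ≤ 3 * (X + n)` by the choice of `K`; bad samples add only a constant to the mean.
  calc (n : ℝ) ^ n * (c * Λ ^ 2 * (K * ρ + n)) + Bad.card * ((m + 2) * (n : ℝ) ^ 2)
      ≤ (n : ℝ) ^ n * (c * Λ ^ 2 * (3 * (X + n))) + (n : ℝ) ^ n * (8 * (m + 1) * (m + 2)) := by
        gcongr
        linarith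
    _ ≤ (n : ℝ) ^ n * (c * Λ ^ 2 * (3 * (X + n))) +
        (n : ℝ) ^ n * (8 * (m + 1) * (m + 2) * (Λ ^ 2 * (3 * (X + n)))) := by
        refine add_le_add le_rfl (mul_le_mul_of_nonneg_left ?_ (by positivity))
        exact le_mul_of_one_le_right (by positivity) hone
    _ = _ := by ring

end RandomizedRoundAlg

theorem theorem1 :
    (∀ r : ℕ, 3 ≤ r →
      ∃ (A : (n k : ℕ) → RandomizedRoundAlg n r) (C : ℝ) (c : ℕ),
        ∀ n k : ℕ, k ≤ n →
          (A n k).AlwaysSolvesSortedTopK k ∧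
          ∀ rank : Equiv.Perm (Fin n),
            (A n k).expectedComparisons rank ≤
              ENNReal.ofReal
                (C * ((n : ℝ) ^ ((2 : ℝ) / (r : ℝ)) * (k : ℝ) ^ (((r : ℝ) - 1) / (r : ℝ)) + (n : ℝ))
                  * (1 + Real.log (n : ℝ)) ^ c)) ∧
    (∃ (A : (n k : ℕ) → RandomizedRoundAlg n 2) (C : ℝ),
      ∀ n k : ℕ, k ≤ n →
        (A n k).AlwaysSolvesSortedTopK k ∧
        ∀ rank : Equiv.Perm (Fin n),
          (A n k).expectedComparisons rank ≤
            ENNReal.ofReal (C * ((n : ℝ) * Real.sqrt (k : ℝ) + (n : ℝ) ^ ((4 : ℝ) / 3)))) := by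
  constructor
  · intro r hr
    obtain ⟨m, rfl⟩ := Nat.exists_eq_add_of_le' (show 2 ≤ r by omega)
    have h := RandomizedRoundAlg.exists_alg_of_three_le_rounds m (by omega)
    -- For `k > n` nothing is claimed, and any algorithm serves as a default.
    refine ⟨fun n k => if hk : k ≤ n then (h n k hk).choose else (h n 0 (Nat.zero_le n)).choose,
      3 * (16 * (42 * m + 33) + 6 + 8 * (m + 1) * (m + 2)), 2, fun n k hk => ?_⟩
    simp only [hk, dite_true]
    exact (h n k hk).choose_spec
  · have h := RandomizedRoundAlg.exists_alg_two_rounds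
    refine ⟨fun n k => if hk : k ≤ n then (h n k hk).choose else (h n 0 (Nat.zero_le n)).choose,
      15, fun n k hk => ?_⟩
    simp only [hk, dite_true]
    exact (h n k hk).choose_spec
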